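/- For $m\ge 3$ alternatives and $n\ge 1$ agents, let $\mathrm{KT}(R,W)$ be the Kendall-tau distance of two rankings (the number of pairs of alternatives that they order differently), and let $\overline{\mathrm{KT}}(P)=\frac1{n(n-1)}\sum_{j,j'\le n}\mathrm{KT}(R_j,R_{j'})$ be the average distance of a profile $P=(R_1,\dots,R_n)$ of rankings ($0$ if $n=1$). For a central profile $P$ and a dispersion vector $\vec\varphi\in(0,1]^n$ let $P'\sim(P,\vec\varphi)$ be the random profile whose rankings $R'_1,\dots,R'_n$ are independent with $\Pr(R'_j=W)\propto\varphi_j^{\mathrm{KT}(R_j,W)}$ (the Mallows model). Let $\mathrm{RT}(P')$ be the running time, on a unit-cost random access machine with addition, subtraction and comparison, of the dynamic programming algorithm of Betzler et al. for computing a Kemeny ranking (a ranking $R$ minimizing $\sum_j \mathrm{KT}(R,R'_j)$), which builds the ranking position by position and, with $d=\max(1,\lceil\overline{\mathrm{KT}}(P')\rceil)$, considers at position $i$ only alternatives whose average position in $P'$ (counted from $0$) lies strictly between $i-d$ and $i+d$, with one table entry for each position $i$, each allowed alternative $c$ at $i$, and each subset $S$ of the other alternatives allowed at $i$ that, together with the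 alternatives no longer allowed from position $i$ on, has $i$ elements. For all constants $c_0>0$, $K_1$, $K_2$ there are a polynomial $p$ with natural number coefficients and a constant $c>0$ such that, for all $m\ge 3$, all $n\ge c_0\,m^2(m-1)^2$ with $n\ge1$, all central profiles $P$ with $\overline{\mathrm{KT}}(P)\le K_1(\log m+\log n)$, all dispersion vectors $\vec\varphi\in(0,1]^n$ with $\frac1n\sum_j\varphi_j\le K_2\,\frac{\log m+\log n}{m^2}$, and all real $t\ge 1$, $$\Pr_{P'\sim(P,\vec\varphi)}\bigl(\mathrm{RT}(P')>p(mn)^t\bigr)\le \exp(-c\,t^2).$$ Hence the algorithm runs in polynomial time with high probability: there is a polynomial $q$ (depending only on $c_0,K_1,K_2$) such that, for every $\delta>0$ and all $m,n,P,\vec\varphi$ as above with $mn$ sufficiently large (depending on $c_0,K_1,K_2,\delta$), $\Pr_{P'\sim(P,\vec\varphi)}\bigl(\mathrm{RT}(P')\le q(mn)\bigr)\ge 1-\delta$. -/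

import Mathlib

/-! ## Rankings, profiles, Kendall-tau distance -/

/-- A ranking (linear order) of the alternatives `0, …, m - 1`, given by the position of each
alternative: `R a` is the position of `a`, position `0` being the top, so that `a ≻_R b` means
`R a < R b`. -/
abbrev Ranking (m : ℕ) : Type := Equiv.Perm (Fin m)

/-- A preference profile: one ranking for each of the `n` agents. -/
abbrev Profile (m n : ℕ) : Type := Fin n → Ranking m

/-- The Kendall-tau distance: the number of pairs `{a, b}` ordered differently by `R` and `W`. -/
def kendallTau {m : ℕ} (R W : Ranking m) : ℕ :=
  (Finset.univ.filter fun p : Fin m × Fin m => R p.1 < R p.2 ∧ W p.2 < W p.1).card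

/-- The average Kendall-tau distance of a profile, `1 / (n (n - 1)) * ∑_{j, j'} KT(R_j, R_j')`
(it is `0` for a single agent). -/
noncomputable def avgKendallTau {m n : ℕ} (P : Profile m n) : ℝ :=
  (∑ j, ∑ j', (kendallTau (P j) (P j') : ℝ)) / ((n : ℝ) * ((n : ℝ) - 1))

/-! ## The Mallows model -/

/-- The normalization constant of the Mallows model. -/
noncomputable def mallowsZ {m : ℕ} (R : Ranking m) (φ : ℝ) : ℝ :=
  ∑ W : Ranking m, φ ^ kendallTau R W

/-- For a positive dispersion the Mallows weights are positive and sum up to `1`. -/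
theorem mallows_hasSum {m : ℕ} (R : Ranking m) (φ : Set.Ioc (0 : ℝ) 1) :
    ∑ W : Ranking m, ENNReal.ofReal ((φ : ℝ) ^ kendallTau R W / mallowsZ R φ) = 1 := by
  have hφ : (0 : ℝ) < φ := φ.2.1
  have hZ : 0 < mallowsZ R φ :=
    Finset.sum_pos (fun W _ => pow_pos hφ _) Finset.univ_nonempty
  rw [← ENNReal.ofReal_sum_of_nonneg fun W _ => (div_pos (pow_pos hφ _) hZ).le,
    ← Finset.sum_div]
  change ENNReal.ofReal (mallowsZ R φ / mallowsZ R φ) = 1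
  rw [div_self hZ.ne', ENNReal.ofReal_one]

/-- The Mallows distribution with central ranking `R` and dispersion `φ ∈ (0, 1]`:
the probability of `W` is `φ ^ KT(R, W) / Z`. -/
noncomputable def mallows {m : ℕ} (R : Ranking m) (φ : Set.Ioc (0 : ℝ) 1) : PMF (Ranking m) :=
  PMF.ofFintype (fun W => ENNReal.ofReal ((φ : ℝ) ^ kendallTau R W / mallowsZ R φ))
    (mallows_hasSum R φ)

instance rankingMeasurableSpace (m : ℕ) : MeasurableSpace (Ranking m) := ⊤

/-- The law of the random profile with central profile `P` and dispersion vector `φ`: the ranking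
of agent `j` is drawn from the Mallows distribution with parameters `P j`, `φ j`, independently
for different agents. -/
noncomputable def mallowsProfile {m n : ℕ} (P : Profile m n) (φ : Fin n → Set.Ioc (0 : ℝ) 1) :
    MeasureTheory.Measure (Profile m n) :=
  MeasureTheory.Measure.pi fun j => (mallows (P j) (φ j)).toMeasure

/-! ## A random access machine with a step count

Programs over finitely many registers (named by `ρ`) and finitely many unbounded arrays (named by
`α`, with up to three indices), all holding natural numbers.  The only arithmetic is addition,
subtraction and comparison; every operation, memory access, test and loop iteration costs one step.
(Without multiplication a word grows by at most one bit per addition, so this unit-cost model is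
polynomially equivalent to Turing machines.) -/

namespace RAM

/-- Arithmetic expressions; `get a i j k` reads the cell `a[i, j, k]`. -/
inductive Expr (ρ α : Type) : Type
  | lit (v : ℕ)
  | var (x : ρ)
  | get (a : α) (i j k : Expr ρ α)
  | add (e f : Expr ρ α)
  | sub (e f : Expr ρ α)

/-- Tests. -/
inductive Test (ρ α : Type) : Type
  | lt (e f : Expr ρ α)
  | eq (e f : Expr ρ α)
  | not (t : Test ρ α)
  | and (t u : Test ρ α)
  | or (t u : Test ρ α)

/-- Programs; `loop x e c` executes `c` for `x = 0, 1, …, e - 1`, where the bound `e` is evaluated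
once, on entry. -/
inductive Cmd (ρ α : Type) : Type
  | skip
  | set (x : ρ) (e : Expr ρ α)
  | put (a : α) (i j k e : Expr ρ α)
  | seq (c d : Cmd ρ α)
  | ite (t : Test ρ α) (c d : Cmd ρ α)
  | loop (x : ρ) (e : Expr ρ α) (c : Cmd ρ α)

/-- The memory of the machine. -/
structure Store (ρ α : Type) : Type where
  reg : ρ → ℕ
  arr : α → ℕ → ℕ → ℕ → ℕ

/-- The value of an expression (subtraction is truncated at `0`). -/
def Expr.eval {ρ α : Type} (s : Store ρ α) : Expr ρ α → ℕ
  | .lit v => v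
  | .var x => s.reg x
  | .get a i j k => s.arr a (i.eval s) (j.eval s) (k.eval s)
  | .add e f => e.eval s + f.eval s
  | .sub e f => e.eval s - f.eval s

/-- The number of steps for evaluating an expression: one per constant, memory access or
arithmetic operation. -/
def Expr.steps {ρ α : Type} : Expr ρ α → ℕ
  | .lit _ => 1
  | .var _ => 1
  | .get _ i j k => i.steps + j.steps + k.steps + 1
  | .add e f => e.steps + f.steps + 1
  | .sub e f => e.steps + f.steps + 1

/-- The outcome of a test. -/
def Test.eval {ρ α : Type} (s : Store ρ α) : Test ρ α → Bool
  | .lt e f => decide (e.eval s < f.eval s)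
  | .eq e f => decide (e.eval s = f.eval s)
  | .not t => !t.eval s
  | .and t u => t.eval s && u.eval s
  | .or t u => t.eval s || u.eval s

/-- The number of steps for evaluating a test (both arguments of a connective are evaluated). -/
def Test.steps {ρ α : Type} : Test ρ α → ℕ
  | .lt e f => e.steps + f.steps + 1
  | .eq e f => e.steps + f.steps + 1
  | .not t => t.steps + 1
  | .and t u => t.steps + u.steps + 1
  | .or t u => t.steps + u.steps + 1

/-- Writing a register. -/
def Store.setReg {ρ α : Type} [DecidableEq ρ] (s : Store ρ α) (x : ρ) (v : ℕ) : Store ρ α :=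
  { s with reg := Function.update s.reg x v }

/-- Writing an array cell. -/
def Store.setArr {ρ α : Type} [DecidableEq α] (s : Store ρ α) (a : α) (i j k v : ℕ) :
    Store ρ α :=
  { s with arr := Function.update s.arr a fun i' j' k' =>
      if i' = i ∧ j' = j ∧ k' = k then v else s.arr a i' j' k' }

/-- Executing a program from the memory `s`: the final memory and the number of steps. -/
def Cmd.exec {ρ α : Type} [DecidableEq ρ] [DecidableEq α] :
    Cmd ρ α → Store ρ α → Store ρ α × ℕ
  | .skip, s => (s, 1)
  | .set x e, s => (s.setReg x (e.eval s), e.steps + 1)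
  | .put a i j k e, s =>
      (s.setArr a (i.eval s) (j.eval s) (k.eval s) (e.eval s),
        i.steps + j.steps + k.steps + e.steps + 1)
  | .seq c d, s => ((d.exec (c.exec s).1).1, (c.exec s).2 + (d.exec (c.exec s).1).2)
  | .ite t c d, s =>
      if t.eval s then ((c.exec s).1, t.steps + 1 + (c.exec s).2)
      else ((d.exec s).1, t.steps + 1 + (d.exec s).2)
  | .loop x e c, s =>
      (List.range (e.eval s)).foldl
        (fun r v => ((c.exec (r.1.setReg x v)).1, r.2 + 1 + (c.exec (r.1.setReg x v)).2))
        (s, e.steps + 1)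

/-- Sequential composition of a list of programs. -/
def Cmd.block {ρ α : Type} : List (Cmd ρ α) → Cmd ρ α
  | [] => .skip
  | c :: cs => .seq c (block cs)

/-- Conditional without alternative. -/
def Cmd.when {ρ α : Type} (t : Test ρ α) (cs : List (Cmd ρ α)) : Cmd ρ α :=
  .ite t (.block cs) .skip

/-- Loop over a block. -/
def Cmd.for {ρ α : Type} (x : ρ) (e : Expr ρ α) (cs : List (Cmd ρ α)) : Cmd ρ α :=
  .loop x e (.block cs)

instance {ρ α : Type} : Coe ρ (Expr ρ α) := ⟨Expr.var⟩
instance {ρ α : Type} (v : ℕ) : OfNat (Expr ρ α) v := ⟨Expr.lit v⟩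
instance {ρ α : Type} : Add (Expr ρ α) := ⟨Expr.add⟩
instance {ρ α : Type} : Sub (Expr ρ α) := ⟨Expr.sub⟩

end RAM

/-! ## The dynamic program of Betzler et al. for the Kemeny rule

Let `p(a)` be the average position of alternative `a` in the profile and `d = ⌈KT⌉` the rounded
average Kendall-tau distance (and `d = 1` if all votes agree, so that `p(a) - d < i < p(a) + d`
always has a solution).  In an optimal ranking every alternative `a` has a position `i` with
`p(a) - d < i < p(a) + d`; let `P i` be the set of the alternatives that are allowed at position
`i` by this condition, and let `F i = P (i - 1) \ P i` be the alternatives forgotten at `i`.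
For `c ∈ P i` and `S ⊆ P i \ {c}` such that `S` together with the alternatives forgotten up to
`i` has `i` elements, `T (i, c, S)` is the least partial Kemeny score over all ways to put these
alternatives on the positions below `i`, and `c` on position `i`:

* `T (0, c, ∅)` is the partial score of `c` against all other alternatives,
* `T (i, c, S) = min_{c' ∈ S ∪ F i} T (i - 1, c', (S ∪ F i) \ {c'})` plus the partial score of `c`
  against the alternatives that are not placed yet,

where the partial score of `c` against a set is the number of pairs of a vote and an element of the
set such that the vote prefers the element to `c`.  The optimum is
`min_{c ∈ P (m - 1)} T (m - 1, c, P (m - 1) \ {c})`, and an optimal ranking is read off by following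
the minimizers back. -/

namespace Kemeny

open RAM

/-- The registers of the program. -/
inductive Reg : Type
  | cands | votes | total | pairs | acc | d | shift | scaled
  | u | v | a | b | i | j | k | s | c | q
  | count | carry | valid | val | best | arg | rest
  deriving DecidableEq

/-- The arrays of the program. -/
inductive Arr : Type
  | pos | sum | win | pow | cand | size | idx | gone | bit | score | ptr | prev | out
  deriving DecidableEq

/-- Expressions, tests and programs over these registers and arrays. -/
abbrev E : Type := Expr Reg Arr
abbrev B : Type := Test Reg Arr
abbrev C : Type := Cmd Reg Arr

/-- `rd1 x e` is `x[e]`, and so on. -/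
def rd1 (x : Arr) (e : E) : E := .get x e 0 0
def rd2 (x : Arr) (e f : E) : E := .get x e f 0
def rd3 (x : Arr) (e f g : E) : E := .get x e f g
def wr1 (x : Arr) (e w : E) : C := .put x e 0 0 w
def wr2 (x : Arr) (e f w : E) : C := .put x e f 0 w
def wr3 (x : Arr) (e f g w : E) : C := .put x e f g w

/-- `x := x + e`. -/
def incr (x : Reg) (e : E) : C := .set x (.var x + e)

/-- The input: `cands = m`, `votes = n`, `pos[u, a]` is the position of alternative `a` in vote `u`;
everything else is `0`. -/
def load {m n : ℕ} (P : Profile m n) : Store Reg Arr where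
  reg
    | .cands => m
    | .votes => n
    | _ => 0
  arr
    | .pos => fun u a _ =>
        if h : u < n ∧ a < m then (P ⟨u, h.1⟩ ⟨a, h.2⟩ : ℕ) else 0
    | _ => fun _ _ _ => 0

/-- `sum[a]` is the sum of the positions of `a`; `win[a, b]` the number of votes preferring `a`
to `b`. -/
def countVotes : C :=
  .for .u Reg.votes [
    .for .a Reg.cands [
      wr1 .sum Reg.a (rd1 .sum Reg.a + rd2 .pos Reg.u Reg.a),
      .for .b Reg.cands [
        .when (.lt (rd2 .pos Reg.u Reg.a) (rd2 .pos Reg.u Reg.b)) [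
          wr2 .win Reg.a Reg.b (rd2 .win Reg.a Reg.b + 1)]]]]

/-- `total = ∑_{u, v} KT(u, v)`, `pairs = n (n - 1)`, `d = max 1 ⌈total / pairs⌉` and
`shift = n d`. -/
def averageDistance : C :=
  .block [
    .for .u Reg.votes [.for .v Reg.votes [.for .a Reg.cands [.for .b Reg.cands [
      .when (.and (.lt (rd2 .pos Reg.u Reg.a) (rd2 .pos Reg.u Reg.b))
          (.lt (rd2 .pos Reg.v Reg.b) (rd2 .pos Reg.v Reg.a))) [
        incr .total 1]]]]],
    .for .u Reg.votes [incr .pairs (.var .votes - 1)],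
    .set .d 1,
    .set .acc Reg.pairs,
    .for .a Reg.cands [.for .b Reg.cands [
      .when (.lt Reg.acc Reg.total) [incr .acc Reg.pairs, incr .d 1]]],
    .for .u Reg.d [incr .shift Reg.votes]]

/-- `pow[a] = 2 ^ a`. -/
def powersOfTwo : C :=
  .block [
    wr1 .pow 0 1,
    .for .a Reg.cands [
      wr1 .pow (.var .a + 1) (rd1 .pow Reg.a + rd1 .pow Reg.a)]]

/-- Lists `P i` as `cand[i, 0], …, cand[i, size[i] - 1]`; `idx[i, a]` is one more than the index of
`a` in this list, and `0` if `a ∉ P i`; `gone[i]` counts the alternatives `a` with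
`p(a) + d ≤ i`, which are those forgotten up to `i`.  Here `scaled = n i`. -/
def allowedSets : C :=
  .block [
    .set .scaled 0,
    .for .i Reg.cands [
      .for .a Reg.cands [
        .when (.and (.lt Reg.scaled (rd1 .sum Reg.a + .var .shift))
            (.lt (rd1 .sum Reg.a) (.var .scaled + .var .shift))) [
          wr2 .cand Reg.i (rd1 .size Reg.i) Reg.a,
          wr1 .size Reg.i (rd1 .size Reg.i + 1),
          wr2 .idx Reg.i Reg.a (rd1 .size Reg.i)],
        .when (.not (.lt Reg.scaled (rd1 .sum Reg.a + .var .shift))) [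
          wr1 .gone Reg.i (rd1 .gone Reg.i + 1)]],
      incr .scaled Reg.votes]]

/-- The element `cand[i - 1, a]` of `P (i - 1)` lies in `F i` or in `S`.  The set `S ⊆ P i` is given
by its characteristic vector `bit[0], …, bit[size[i] - 1]`. -/
def inPrevious : B :=
  .or (.eq (rd2 .idx Reg.i (rd2 .cand (.var .i - 1) Reg.a)) 0)
    (.eq (rd1 .bit (rd2 .idx Reg.i (rd2 .cand (.var .i - 1) Reg.a) - 1)) 1)

/-- One more than `min_{c' ∈ S ∪ F i} T (i - 1, c', (S ∪ F i) \ {c'})`, or `0` if there is no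
defined entry; `arg` and `rest` record the minimizing entry.  The set `S ∪ F i`, which has to be
a subset of `P (i - 1)`, is encoded as the number `q` whose binary digits are its characteristic
vector in the list of `P (i - 1)`. -/
def minimizePrevious : C :=
  .block [
    .set .q 0,
    .set .valid 1,
    .for .a (rd1 .size (.var .i - 1)) [
      .when inPrevious [incr .q (rd1 .pow Reg.a)]],
    .for .a Reg.k [
      .when (.and (.eq (rd1 .bit Reg.a) 1)
          (.eq (rd2 .idx (.var .i - 1) (rd2 .cand Reg.i Reg.a)) 0)) [
        .set .valid 0]],
    .when (.eq Reg.valid 1) [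
      .for .a (rd1 .size (.var .i - 1)) [
        .when inPrevious [
          .set .val (rd3 .score (.var .i - 1) Reg.a (.var .q - rd1 .pow Reg.a)),
          .when (.and (.lt 0 Reg.val) (.or (.eq Reg.best 0) (.lt Reg.val Reg.best))) [
            .set .best Reg.val,
            .set .arg Reg.a,
            .set .rest (.var .q - rd1 .pow Reg.a)]]]]]

/-- Adds to `best` the partial score of `c` against the alternatives that are not placed yet: those
of `P i` outside `S ∪ {c}`, and those that are introduced after `i`. -/
def addPartialScore : C :=
  .for .b Reg.cands [
    .when (.and (.not (.eq Reg.b Reg.c))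
        (.or
          (.and (.eq (rd2 .idx Reg.i Reg.b) 0)
            (.not (.lt (rd1 .sum Reg.b) (.var .scaled + .var .shift))))
          (.and (.lt 0 (rd2 .idx Reg.i Reg.b))
            (.eq (rd1 .bit (rd2 .idx Reg.i Reg.b - 1)) 0)))) [
      incr .best (rd2 .win Reg.b Reg.c)]]

/-- The entry `T (i, c, S)` with `c = cand[i, j]`, where `s` is the binary encoding of `S`:
`score[i, j, s]` is `T (i, c, S) + 1`, or `0` if this entry is undefined. -/
def computeEntry : C :=
  .block [
    .set .c (rd2 .cand Reg.i Reg.j),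
    .set .best 0,
    .set .arg 0,
    .set .rest 0,
    .ite (.eq Reg.i 0) (.set .best 1) minimizePrevious,
    .when (.lt 0 Reg.best) [
      addPartialScore,
      wr3 .score Reg.i Reg.j Reg.s Reg.best,
      wr3 .ptr Reg.i Reg.j Reg.s Reg.arg,
      wr3 .prev Reg.i Reg.j Reg.s Reg.rest]]

/-- Adds `1` to the binary number `bit[0], …, bit[k - 1]`. -/
def nextSubset : C :=
  .block [
    .set .carry 1,
    .for .a Reg.k [
      .when (.eq Reg.carry 1) [
        .ite (.eq (rd1 .bit Reg.a) 0)
          (.block [wr1 .bit Reg.a 1, .set .carry 0])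
          (wr1 .bit Reg.a 0)]]]

/-- For every position `i`, every `c ∈ P i` and every `S ⊆ P i \ {c}` of the right size, computes
the entry `T (i, c, S)`. -/
def fillTable : C :=
  .block [
    .set .scaled 0,
    .for .i Reg.cands [
      .set .k (rd1 .size Reg.i),
      .for .j Reg.k [
        .for .a Reg.k [wr1 .bit Reg.a 0],
        .for .s (rd1 .pow Reg.k) [
          .when (.eq (rd1 .bit Reg.j) 0) [
            .set .count (rd1 .gone Reg.i),
            .for .a Reg.k [incr .count (rd1 .bit Reg.a)],
            .when (.eq Reg.count Reg.i) [computeEntry]],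
          nextSubset]],
      incr .scaled Reg.votes]]

/-- Finds the optimal entry for the last position and follows the minimizers back; `out[i]` is the
alternative at position `i` of the ranking found. -/
def traceBack : C :=
  .block [
    .set .i (.var .cands - 1),
    .set .k (rd1 .size Reg.i),
    .set .best 0,
    .set .j 0,
    .set .s 0,
    .for .a Reg.k [
      .set .q (rd1 .pow Reg.k - 1 - rd1 .pow Reg.a),
      .set .val (rd3 .score Reg.i Reg.a Reg.q),
      .when (.and (.lt 0 Reg.val) (.or (.eq Reg.best 0) (.lt Reg.val Reg.best))) [
        .set .best Reg.val,
        .set .j Reg.a,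
        .set .s Reg.q]],
    .for .a Reg.cands [
      .set .i (.var .cands - 1 - .var .a),
      wr1 .out Reg.i (rd2 .cand Reg.i Reg.j),
      .set .arg (rd3 .ptr Reg.i Reg.j Reg.s),
      .set .s (rd3 .prev Reg.i Reg.j Reg.s),
      .set .j Reg.arg]]

/-- The whole algorithm. -/
def program : C :=
  .block [countVotes, averageDistance, powersOfTwo, allowedSets, fillTable, traceBack]

/-- The number of steps of the algorithm on the profile `P`. -/
def runtime {m n : ℕ} (P : Profile m n) : ℕ := (program.exec (load P)).2

/-- The ranking computed by the algorithm on the profile `P`: the alternative at position `i`. -/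
def output {m n : ℕ} (P : Profile m n) (i : ℕ) : ℕ := (program.exec (load P)).1.arr .out i 0 0

end Kemeny

/-! The running time is `(m n) ^ O(1) * 2 ^ O(d)` for the rounded average distance `d`, and in the
Mallows model `d` is `O(log m + log n)` up to a deviation `s` whose probability is at most
`exp (-c s ^ 2)`.

*Running time.* Every loop of the program runs over votes, alternatives, the range `d`, the list of
the alternatives allowed at a position, or the subsets of this list. If `N` bounds all these ranges,
the number of steps is bounded by a fixed polynomial in `N` (`RAM.Cmd.bound_le`). A Hoare logic with
step bounds (`RAM.Runs`) shows that the program computes the sums of positions exactly and that its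
value of `d` lies between the average distance and its rounding (`Kemeny.program_runs`). At most
`10 d` alternatives are allowed at a position (`card_allowed_le`): by the inequality between
Spearman's footrule and the Kendall-tau distance (`footrule_le`), the alternatives deviate from
their average positions by at most `2 d` in total on average over the votes, but `k` alternatives
occupy `k` different positions in each vote, so that their distances from a fixed position add up to
the order of `k ^ 2`. This gives `Kemeny.exists_runtime_le`.

*Concentration.* By the triangle inequality the average distance of the random profile exceeds that
of the central profile by at most `2 / n` times the sum of the distances of the random rankings from
their central rankings (`avgKendallTau_le`). This sum has independent summands in `[0, m (m - 1)]`,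
to which Hoeffding's inequality applies; as `n` is at least of the order of `m ^ 4`, its tail does
not depend on `m` and `n` (`mallowsProfile_avgKendallTau_ge`). The expectation of a summand is at
most `m ^ 2 φ`, because each pair of alternatives is inverted with probability at most `φ`:
exchanging an inverted pair decreases the Kendall-tau distance (`kendallTau_swap_lt`), which
multiplies the weight by at least `1 / φ`.

For the bound with exponent `t` the deviation is taken to be `t`, and for the bound with high
probability `log (m n)`, which costs only another power of `m n`. -/

/-! ### Step bounds for programs -/

namespace RAM

variable {ρ α : Type}

/-- The program never assigns the register `x`, neither directly nor as a loop counter. -/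
def Cmd.KeepsReg (x : ρ) : Cmd ρ α → Prop
  | .skip => True
  | .set y _ => x ≠ y
  | .put _ _ _ _ _ => True
  | .seq c d => c.KeepsReg x ∧ d.KeepsReg x
  | .ite _ c d => c.KeepsReg x ∧ d.KeepsReg x
  | .loop y _ c => x ≠ y ∧ c.KeepsReg x

/-- The program never writes to the array `a`. -/
def Cmd.KeepsArr (a : α) : Cmd ρ α → Prop
  | .skip => True
  | .set _ _ => True
  | .put b _ _ _ _ => a ≠ b
  | .seq c d => c.KeepsArr a ∧ d.KeepsArr a
  | .ite _ c d => c.KeepsArr a ∧ d.KeepsArr a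
  | .loop _ _ c => c.KeepsArr a

/-- The number of steps of the program if every loop ran for `N` iterations and every conditional
executed both branches. -/
def Cmd.bound (N : ℕ) : Cmd ρ α → ℕ
  | .skip => 1
  | .set _ e => e.steps + 1
  | .put _ i j k e => i.steps + j.steps + k.steps + e.steps + 1
  | .seq c d => c.bound N + d.bound N
  | .ite t c d => t.steps + 1 + (c.bound N + d.bound N)
  | .loop _ e c => e.steps + 1 + N * (1 + c.bound N)

/-- The nesting depth of the loops of a program. -/
def Cmd.depth : Cmd ρ α → ℕ
  | .skip => 0
  | .set _ _ => 0
  | .put _ _ _ _ _ => 0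
  | .seq c d => max c.depth d.depth
  | .ite _ c d => max c.depth d.depth
  | .loop _ _ c => c.depth + 1

/-- A program with `d` nested loops has at most `O(N ^ d)` steps if the loops are bounded
by `N`. -/
theorem Cmd.bound_le (c : Cmd ρ α) {N : ℕ} (hN : 1 ≤ N) :
    c.bound N ≤ c.bound 1 * N ^ c.depth := by
  have mono : ∀ (A i j : ℕ), i ≤ j → A * N ^ i ≤ A * N ^ j := fun A i j h =>
    Nat.mul_le_mul_left _ (Nat.pow_le_pow_right hN h)
  have base : ∀ A j : ℕ, A ≤ A * N ^ j := fun A j =>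
    Nat.le_mul_of_pos_right _ (Nat.pow_pos hN)
  induction c with
  | skip => simp [bound, depth]
  | set => simp [bound, depth]
  | put => simp [bound, depth]
  | seq c d hc hd =>
    simp only [bound, depth, add_mul]
    exact add_le_add (hc.trans (mono _ _ _ (le_max_left _ _)))
      (hd.trans (mono _ _ _ (le_max_right _ _)))
  | ite t c d hc hd =>
    simp only [bound, depth]
    rw [add_mul, add_mul (c.bound 1)]
    exact add_le_add (base _ _) (add_le_add (hc.trans (mono _ _ _ (le_max_left _ _)))
      (hd.trans (mono _ _ _ (le_max_right _ _))))
  | loop x e c hc =>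
    simp only [bound, depth]
    rw [add_mul, one_mul, add_mul, one_mul, pow_succ']
    refine add_le_add ?_ ?_
    · have := base (e.steps + 1) (c.depth + 1)
      rwa [add_mul, one_mul, pow_succ'] at this
    · calc N * (1 + c.bound N) ≤ N * (N ^ c.depth + c.bound 1 * N ^ c.depth) :=
            Nat.mul_le_mul_left _ (add_le_add (Nat.one_le_pow _ _ hN) hc)
        _ = _ := by ring

@[simp] theorem Store.setReg_reg [DecidableEq ρ] (s : Store ρ α) (x y : ρ) (v : ℕ) :
    (s.setReg x v).reg y = if y = x then v else s.reg y := by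
  simp [Store.setReg, Function.update_apply]

@[simp] theorem Store.setReg_arr [DecidableEq ρ] (s : Store ρ α) (x : ρ) (v : ℕ) :
    (s.setReg x v).arr = s.arr := rfl

@[simp] theorem Store.setArr_reg [DecidableEq α] (s : Store ρ α) (a : α) (i j k v : ℕ) :
    (s.setArr a i j k v).reg = s.reg := rfl

@[simp] theorem Store.setArr_arr [DecidableEq α] (s : Store ρ α) (a b : α)
    (i j k v i' j' k' : ℕ) :
    (s.setArr a i j k v).arr b i' j' k' =
      if b = a ∧ i' = i ∧ j' = j ∧ k' = k then v else s.arr b i' j' k' := by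
  by_cases h : b = a
  · subst h; simp [Store.setArr]
  · simp [Store.setArr, h]

section eval

variable (s : Store ρ α)

@[simp] theorem Expr.eval_var (x : ρ) : (Expr.var x : Expr ρ α).eval s = s.reg x := rfl

@[simp] theorem Expr.eval_zero : (0 : Expr ρ α).eval s = 0 := rfl

@[simp] theorem Expr.eval_one : (1 : Expr ρ α).eval s = 1 := rfl

@[simp] theorem Expr.eval_add (e f : Expr ρ α) : (e + f).eval s = e.eval s + f.eval s := rfl

@[simp] theorem Expr.eval_sub (e f : Expr ρ α) : (e - f).eval s = e.eval s - f.eval s := rfl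

@[simp] theorem Expr.eval_get (a : α) (i j k : Expr ρ α) :
    (Expr.get a i j k).eval s = s.arr a (i.eval s) (j.eval s) (k.eval s) := rfl

end eval

variable [DecidableEq ρ] [DecidableEq α]

/-! ### Rules for total correctness with a bound for the number of steps -/

/-- The program `c`, started from the memory `s`, ends in a memory with the property `Q` after at
most as many steps as it would take if each of its loops ran for `N` iterations. -/
def Runs (N : ℕ) (c : Cmd ρ α) (s : Store ρ α) (Q : Store ρ α → Prop) : Prop :=
  Q (c.exec s).1 ∧ (c.exec s).2 ≤ c.bound N

variable {N : ℕ} {s : Store ρ α} {Q R : Store ρ α → Prop} {c d : Cmd ρ α}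

theorem Runs.mono (h : Runs N c s R) (hQ : ∀ s', R s' → Q s') : Runs N c s Q :=
  ⟨hQ _ h.1, h.2⟩

theorem Runs.skip (h : Q s) : Runs N .skip s Q := ⟨h, le_rfl⟩

theorem Runs.set {x : ρ} {e : Expr ρ α} (h : Q (s.setReg x (e.eval s))) :
    Runs N (.set x e) s Q := ⟨h, le_rfl⟩

theorem Runs.put {a : α} {i j k e : Expr ρ α}
    (h : Q (s.setArr a (i.eval s) (j.eval s) (k.eval s) (e.eval s))) :
    Runs N (.put a i j k e) s Q := ⟨h, le_rfl⟩

theorem Runs.seq (hc : Runs N c s R) (hd : ∀ s', R s' → Runs N d s' Q) :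
    Runs N (.seq c d) s Q :=
  ⟨(hd _ hc.1).1, add_le_add hc.2 (hd _ hc.1).2⟩

theorem Runs.ite {t : Test ρ α} (hc : t.eval s = true → Runs N c s Q)
    (hd : t.eval s = false → Runs N d s Q) : Runs N (.ite t c d) s Q := by
  unfold Runs
  simp only [Cmd.exec, Cmd.bound]
  split
  · rename_i h
    obtain ⟨h₁, h₂⟩ := hc h
    exact ⟨h₁, by simp only; omega⟩
  · rename_i h
    obtain ⟨h₁, h₂⟩ := hd (by simpa using h)
    exact ⟨h₁, by simp only; omega⟩

theorem Runs.block_nil (h : Q s) : Runs N (.block []) s Q := Runs.skip h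

theorem Runs.block_cons {cs : List (Cmd ρ α)} (hc : Runs N c s R)
    (hd : ∀ s', R s' → Runs N (.block cs) s' Q) : Runs N (.block (c :: cs)) s Q :=
  Runs.seq hc hd

theorem Runs.block_singleton (hc : Runs N c s Q) : Runs N (.block [c]) s Q :=
  Runs.block_cons hc fun _ => Runs.block_nil

theorem Runs.block_set {x : ρ} {e : Expr ρ α} {cs : List (Cmd ρ α)}
    (h : Runs N (.block cs) (s.setReg x (e.eval s)) Q) :
    Runs N (.block (.set x e :: cs)) s Q :=
  Runs.seq (R := (· = s.setReg x (e.eval s))) (Runs.set rfl) fun _ h' => h' ▸ h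

theorem Runs.block_put {a : α} {i j k e : Expr ρ α} {cs : List (Cmd ρ α)}
    (h : Runs N (.block cs) (s.setArr a (i.eval s) (j.eval s) (k.eval s) (e.eval s)) Q) :
    Runs N (.block (.put a i j k e :: cs)) s Q :=
  Runs.seq (R := (· = s.setArr a (i.eval s) (j.eval s) (k.eval s) (e.eval s))) (Runs.put rfl)
    fun _ h' => h' ▸ h

theorem Runs.when {t : Test ρ α} {cs : List (Cmd ρ α)}
    (hc : t.eval s = true → Runs N (.block cs) s Q) (hd : t.eval s = false → Q s) :
    Runs N (.when t cs) s Q :=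
  Runs.ite hc fun h => Runs.skip (hd h)

/-- The invariant rule for loops: `I v` holds before the iteration with counter `v`. -/
theorem Runs.loop {x : ρ} {e : Expr ρ α} (I : ℕ → Store ρ α → Prop) (h₀ : I 0 s)
    (hN : e.eval s ≤ N)
    (hstep : ∀ v < e.eval s, ∀ s', I v s' → Runs N c (s'.setReg x v) (I (v + 1)))
    (hQ : ∀ s', I (e.eval s) s' → Q s') :
    Runs N (.loop x e c) s Q := by
  unfold Runs
  simp only [Cmd.exec, Cmd.bound]
  have key : ∀ k ≤ e.eval s,
      I k ((List.range k).foldl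
        (fun r v => ((c.exec (r.1.setReg x v)).1, r.2 + 1 + (c.exec (r.1.setReg x v)).2))
        (s, e.steps + 1)).1 ∧
      ((List.range k).foldl
        (fun r v => ((c.exec (r.1.setReg x v)).1, r.2 + 1 + (c.exec (r.1.setReg x v)).2))
        (s, e.steps + 1)).2 ≤ e.steps + 1 + k * (1 + c.bound N) := by
    intro k hk
    induction k with
    | zero => simpa using h₀
    | succ k ih =>
      obtain ⟨h₁, h₂⟩ := ih (by omega)
      obtain ⟨h₃, h₄⟩ := hstep k (by omega) _ h₁
      simp only [List.range_succ, List.foldl_append, List.foldl_cons, List.foldl_nil]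
      refine ⟨h₃, ?_⟩
      rw [add_mul, one_mul]
      omega
  obtain ⟨h₁, h₂⟩ := key _ le_rfl
  exact ⟨hQ _ h₁, h₂.trans (by gcongr)⟩

/-- The invariant rule for loops over a block. -/
theorem Runs.for {x : ρ} {e : Expr ρ α} {cs : List (Cmd ρ α)} (I : ℕ → Store ρ α → Prop)
    (h₀ : I 0 s) (hN : e.eval s ≤ N)
    (hstep : ∀ v < e.eval s, ∀ s', I v s' → Runs N (.block cs) (s'.setReg x v) (I (v + 1)))
    (hQ : ∀ s', I (e.eval s) s' → Q s') :
    Runs N (.for x e cs) s Q :=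
  Runs.loop I h₀ hN hstep hQ

/-- A loop whose body adds `g v` to the register `r` in the iteration `v`, and preserves `F`,
adds the sum of these values. -/
theorem Runs.for_add {x r : ρ} {e : Expr ρ α} {cs : List (Cmd ρ α)} (F : Store ρ α → Prop)
    (g : ℕ → ℕ) {M : ℕ} (h₀ : F s) (hM : e.eval s = M) (hN : M ≤ N)
    (hstep : ∀ v < M, ∀ s', F s' → Runs N (.block cs) (s'.setReg x v)
      fun s'' => F s'' ∧ s''.reg r = s'.reg r + g v) :
    Runs N (.for x e cs) s fun s' => F s' ∧ s'.reg r = s.reg r + ∑ v ∈ Finset.range M, g v := by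
  subst hM
  refine Runs.for (fun v s' => F s' ∧ s'.reg r = s.reg r + ∑ u ∈ Finset.range v, g u)
    ⟨h₀, by simp⟩ hN (fun v hv s' hs' => (hstep v hv s' hs'.1).mono fun s'' hs'' => ⟨hs''.1, ?_⟩)
    fun _ h => h
  rw [hs''.2, hs'.2, Finset.sum_range_succ, add_assoc]

/-- Every atomic command of the program preserves `I`, and `I` bounds all loops by `N`. This is a
condition on the commands one by one, and independent of the control flow. -/
def Cmd.Preserves (I : Store ρ α → Prop) (N : ℕ) : Cmd ρ α → Prop
  | .skip => True
  | .set x e => ∀ s, I s → I (s.setReg x (e.eval s))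
  | .put a i j k e =>
      ∀ s, I s → I (s.setArr a (i.eval s) (j.eval s) (k.eval s) (e.eval s))
  | .seq c d => c.Preserves I N ∧ d.Preserves I N
  | .ite _ c d => c.Preserves I N ∧ d.Preserves I N
  | .loop x e c => (∀ s, I s → e.eval s ≤ N) ∧ (∀ s v, I s → I (s.setReg x v)) ∧ c.Preserves I N

theorem Cmd.Preserves.runs {I : Store ρ α → Prop} (h : c.Preserves I N) (hs : I s) :
    Runs N c s I := by
  induction c generalizing s with
  | skip => exact .skip hs
  | set => exact .set (h _ hs)
  | put => exact .put (h _ hs)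
  | seq c d hc hd => exact .seq (hc h.1 hs) fun s' hs' => hd h.2 hs'
  | ite t c d hc hd => exact .ite (fun _ => hc h.1 hs) fun _ => hd h.2 hs
  | loop x e c hc =>
    exact .loop (fun _ => I) hs (h.1 _ hs) (fun v _ s' hs' => hc h.2.2 (h.2.1 _ _ hs'))
      fun _ h => h

/-! ### Memory that a program does not touch -/

/-- The values of registers that are not assigned do not change. -/
theorem Cmd.KeepsReg.exec {x : ρ} (h : c.KeepsReg x) (s : Store ρ α) :
    (c.exec s).1.reg x = s.reg x := by
  induction c generalizing s with
  | skip => rfl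
  | set y e => simp [Cmd.exec, if_neg (show x ≠ y from h)]
  | put => rfl
  | seq c d hc hd => simp only [Cmd.exec]; rw [hd h.2, hc h.1]
  | ite t c d hc hd =>
    simp only [Cmd.exec]
    split
    · exact hc h.1 s
    · exact hd h.2 s
  | loop y e c hc =>
    simp only [Cmd.exec]
    generalize List.range (e.eval s) = l
    suffices ∀ r : Store ρ α × ℕ, (l.foldl
        (fun r v => ((c.exec (r.1.setReg y v)).1, r.2 + 1 + (c.exec (r.1.setReg y v)).2))
        r).1.reg x = r.1.reg x from this _
    induction l with
    | nil => intro r; rfl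
    | cons v l ih =>
      intro r
      rw [List.foldl_cons, ih, hc h.2]
      simp [if_neg h.1]

/-- The contents of arrays that are not written to do not change. -/
theorem Cmd.KeepsArr.exec {a : α} (h : c.KeepsArr a) (s : Store ρ α) :
    (c.exec s).1.arr a = s.arr a := by
  induction c generalizing s with
  | skip => rfl
  | set y e => rfl
  | put b i j k e =>
    funext i' j' k'
    simp [Cmd.exec, show a ≠ b from h]
  | seq c d hc hd => simp only [Cmd.exec]; rw [hd h.2, hc h.1]
  | ite t c d hc hd =>
    simp only [Cmd.exec]
    split
    · exact hc h.1 s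
    · exact hd h.2 s
  | loop y e c hc =>
    simp only [Cmd.exec]
    generalize List.range (e.eval s) = l
    suffices ∀ r : Store ρ α × ℕ, (l.foldl
        (fun r v => ((c.exec (r.1.setReg y v)).1, r.2 + 1 + (c.exec (r.1.setReg y v)).2))
        r).1.arr a = r.1.arr a from this _
    induction l with
    | nil => intro r; rfl
    | cons v l ih =>
      intro r
      rw [List.foldl_cons, ih, hc h]
      simp

end RAM

/-! ### The phases of the algorithm -/

namespace Kemeny

open RAM Finset

section steps

variable {m n N : ℕ}

/-- The memory holds the positions `x u a` of the alternatives `a` in the votes `u`, with `m`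
alternatives and `n` votes. -/
def HasInput (m n : ℕ) (x : ℕ → ℕ → ℕ) (s : Store Reg Arr) : Prop :=
  s.reg .cands = m ∧ s.reg .votes = n ∧ ∀ u a, s.arr .pos u a 0 = x u a

variable {x : ℕ → ℕ → ℕ} {s : Store Reg Arr}

/-- `sum[a]` is the sum of the positions of `a`. -/
theorem countVotes_runs (hm : m ≤ N) (hn : n ≤ N) (hs : HasInput m n x s)
    (hsum : ∀ a, s.arr .sum a 0 0 = 0) :
    Runs N countVotes s fun s' => HasInput m n x s' ∧
      ∀ a, s'.arr .sum a 0 0 = if a < m then ∑ u ∈ range n, x u a else 0 := by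
  refine Runs.for (fun v s' => HasInput m n x s' ∧
      ∀ a, s'.arr .sum a 0 0 = if a < m then ∑ u ∈ range v, x u a else 0)
    ⟨hs, by simpa using hsum⟩ (by simp [hs.2.1, hn]) ?_ ?_
  · rintro u - s' ⟨h, hS⟩
    refine Runs.block_singleton (Runs.for (fun v s' => HasInput m n x s' ∧ s'.reg .u = u ∧
      ∀ a, s'.arr .sum a 0 0 =
        if a < v then ∑ u ∈ range (u + 1), x u a
        else if a < m then ∑ u ∈ range u, x u a else 0) ?_ ?_ ?_ ?_)
    · simpa [HasInput] using ⟨h, hS⟩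
    · simp [h.1, hm]
    · intro a ha t ht
      have ha : a < m := by simpa [h.1] using ha
      obtain ⟨ht, hu, hS⟩ := ht
      refine Runs.block_put (Runs.block_singleton (Cmd.Preserves.runs ?_ ?_))
      · simp [Cmd.for, Cmd.when, Cmd.block, Cmd.Preserves, wr2, HasInput]
        grind
      · refine ⟨?_, ?_, ?_⟩
        · simpa [HasInput] using ht
        · simpa using hu
        · intro b
          have := hS a
          simp [ha] at this
          by_cases hb : b = a
          · subst hb
            simp [rd1, rd2, ht.2.2, hu, this, sum_range_succ]
          · simp [hb, hS b]
            grind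
    · rintro t ⟨ht, -, hS⟩
      refine ⟨ht, fun a => ?_⟩
      have := hS a
      simp [h.1] at this
      grind
  · simp [hs.2.1]

/-- The number of pairs of alternatives that the votes `u` and `v` order differently. -/
def inversions (m : ℕ) (x : ℕ → ℕ → ℕ) (u v : ℕ) : ℕ :=
  ∑ a ∈ range m, ∑ b ∈ range m, if x u a < x u b ∧ x v b < x v a then 1 else 0

/-- The distance `d` computed by the program is at most `D`, which bounds `max 1 ⌈total / pairs⌉`,
and at least `total / pairs`. -/
theorem averageDistance_runs {D : ℕ} (hm : m ≤ N) (hn : n ≤ N) (hD : D ≤ N)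
    (hs : HasInput m n x s)
    (hd : ∀ d, d ≤ 1 ∨ n * (n - 1) * (d - 1) < ∑ u ∈ range n, ∑ v ∈ range n, inversions m x u v →
      d ≤ D)
    (htotal : s.reg .total = 0) (hpairs : s.reg .pairs = 0) (hshift : s.reg .shift = 0) :
    Runs N averageDistance s fun s' => ∃ d ≤ D, s'.reg .shift = n * d ∧
      ∑ u ∈ range n, ∑ v ∈ range n, inversions m x u v ≤ n * (n - 1) * d := by
  -- every pair of votes contributes at most `m ^ 2` inversions, so that `m ^ 2` increments suffice
  have hle : ∑ u ∈ range n, ∑ v ∈ range n, inversions m x u v ≤ n * (n - 1) * (m * m + 1) := by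
    have hinv : ∀ u v, inversions m x u v ≤ if u = v then 0 else m * m := by
      intro u v
      split
      · rename_i h
        subst h
        simp only [inversions, Nat.le_zero, sum_eq_zero_iff]
        intro a _ b _
        exact if_neg (by omega)
      · calc inversions m x u v ≤ ∑ a ∈ range m, ∑ b ∈ range m, 1 :=
              sum_le_sum fun a _ => sum_le_sum fun b _ => by split <;> simp
          _ = m * m := by simp
    calc _ ≤ ∑ u ∈ range n, ∑ v ∈ range n, (if u = v then 0 else m * m) :=
          sum_le_sum fun u _ => sum_le_sum fun v _ => hinv u v
      _ = ∑ u ∈ range n, (n - 1) * (m * m) := by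
          refine sum_congr rfl fun u hu => ?_
          rw [← sum_filter_add_sum_filter_not (range n) (fun v => u = v), sum_filter,
            sum_filter]
          have : ∀ v ∈ range n, (if u = v then (if u = v then 0 else m * m) else 0) = 0 := by
            intro v _; split <;> simp [*]
          rw [sum_eq_zero this, ← sum_filter]
          have h2 : ∀ v ∈ (range n).filter (fun v => ¬ u = v),
              (if u = v then 0 else m * m) = m * m := fun v hv => by
            rw [if_neg (mem_filter.1 hv).2]
          rw [sum_congr rfl h2, sum_const, zero_add, smul_eq_mul,
            show (range n).filter (fun v => ¬ u = v) = (range n).erase u by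
              ext v; simp [and_comm, eq_comm],
            card_erase_of_mem hu, card_range]
      _ = n * (n - 1) * (m * m) := by simp [mul_assoc]
      _ ≤ _ := Nat.mul_le_mul_left _ (by omega)
  generalize hT : ∑ u ∈ range n, ∑ v ∈ range n, inversions m x u v = T at *
  refine Runs.block_cons (R := fun s' => (HasInput m n x s' ∧ s'.reg .pairs = 0 ∧
    s'.reg .shift = 0) ∧ s'.reg .total = T) ?_ ?_
  · rw [← hT]
    refine Runs.mono (Runs.for_add (fun s' => HasInput m n x s' ∧ s'.reg .pairs = 0 ∧
      s'.reg .shift = 0) (r := .total) (M := n) _ ⟨hs, hpairs, hshift⟩ hs.2.1 hn ?_)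
      (fun s' hs' => ⟨hs'.1, by rw [hs'.2, htotal, zero_add]⟩)
    intro u _ s₁ h₁
    refine Runs.block_singleton <| Runs.mono (Runs.for_add (fun s' => (HasInput m n x s' ∧
      s'.reg .pairs = 0 ∧ s'.reg .shift = 0) ∧ s'.reg .u = u) (r := .total) (M := n) _ ?_ ?_ hn ?_)
      (fun s' hs' => ⟨hs'.1.1, hs'.2⟩)
    · simpa [HasInput] using h₁
    · simpa using h₁.1.2.1
    intro v _ s₂ h₂
    refine Runs.block_singleton <| Runs.mono (Runs.for_add (fun s' => (HasInput m n x s' ∧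
      s'.reg .pairs = 0 ∧ s'.reg .shift = 0) ∧ s'.reg .u = u ∧ s'.reg .v = v)
      (r := .total) (M := m) _ ?_ ?_ hm ?_)
      (fun s' hs' => ⟨⟨hs'.1.1, hs'.1.2.1⟩, hs'.2⟩)
    · simpa [HasInput] using h₂
    · simpa using h₂.1.1.1
    intro a _ s₃ h₃
    refine Runs.block_singleton <| Runs.mono (Runs.for_add (fun s' => (HasInput m n x s' ∧
      s'.reg .pairs = 0 ∧ s'.reg .shift = 0) ∧ s'.reg .u = u ∧ s'.reg .v = v ∧ s'.reg .a = a)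
      (r := .total) (M := m) _ ?_ ?_ hm ?_)
      (fun s' hs' => ⟨⟨hs'.1.1, hs'.1.2.1, hs'.1.2.2.1⟩, hs'.2⟩)
    · simpa [HasInput] using h₃
    · simpa using h₃.1.1.1
    intro b _ s₄ h₄
    refine Runs.block_singleton <| Runs.when (fun ht => Runs.block_set (Runs.block_nil ?_))
      (fun ht => ?_)
    · simp [Test.eval, rd2, h₄.1.1.2.2, h₄.2] at ht
      simpa [HasInput, ht] using h₄
    · simp [Test.eval, rd2, h₄.1.1.2.2, h₄.2] at ht
      have ht' : ¬ (x u a < x u b ∧ x v b < x v a) := by omega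
      simpa [HasInput, ht'] using h₄
  rintro s₁ ⟨⟨h₁, hp₁, hs₁⟩, hT₁⟩
  refine Runs.block_cons (Runs.for_add (fun s' => HasInput m n x s' ∧ s'.reg .shift = 0 ∧
    s'.reg .total = T) (r := .pairs) (fun _ => n - 1) (M := n) ⟨h₁, hs₁, hT₁⟩ h₁.2.1 hn ?_) ?_
  · intro u _ s' hs'
    refine Runs.block_set (Runs.block_nil ?_)
    have := hs'.1.2.1
    simpa [HasInput, this] using hs'
  rintro s₂ ⟨⟨h₂, hs₂, hT₂⟩, hp₂⟩
  rw [hp₁, zero_add, sum_const, card_range, smul_eq_mul] at hp₂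
  refine Runs.block_set (Runs.block_set ?_)
  generalize n * (n - 1) = p at *
  -- after `k` tests, `d` has been increased in each of them, unless `acc` has reached `total`
  let I : ℕ → Store Reg Arr → Prop := fun k s' => HasInput m n x s' ∧ s'.reg .shift = 0 ∧
    s'.reg .total = T ∧ s'.reg .pairs = p ∧ s'.reg .acc = p * s'.reg .d ∧
    (s'.reg .d ≤ 1 ∨ p * (s'.reg .d - 1) < T) ∧ 1 ≤ s'.reg .d ∧
    (s'.reg .acc < T → s'.reg .d = k + 1)
  refine Runs.block_cons (R := I (m * m)) (Runs.for (fun a s' => I (a * m) s') ?_ ?_ ?_ ?_) ?_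
  · simpa [I, HasInput, hT₂, hp₂, hs₂] using h₂
  · simp [h₂.1, hm]
  · intro a _ s' hs'
    refine Runs.block_singleton (Runs.for (fun b s' => I (a * m + b) s') ?_ ?_ ?_ ?_)
    · simpa [I, HasInput] using hs'
    · simp [hs'.1.1, hm]
    · rintro b - t ⟨ht, ht₁, ht₂, ht₃, ht₄, ht₅, ht₆, ht₇⟩
      refine Runs.block_singleton (Runs.when (fun h => Runs.block_set <| Runs.block_set <|
        Runs.block_nil ?_) (fun h => ?_))
      · simp [Test.eval, ht₂] at h
        have h' := ht₇ h
        rw [ht₄] at h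
        refine ⟨by simpa [HasInput] using ht, by simpa using ht₁, by simpa using ht₂,
          by simpa using ht₃, ?_, ?_, ?_, ?_⟩
        · simp [ht₃, ht₄, mul_add]
        · simp [h]
        · simp
        · simp [h', add_assoc]
      · simp [Test.eval, ht₂] at h
        refine ⟨by simpa [HasInput] using ht, by simpa using ht₁, by simpa using ht₂,
          by simpa using ht₃, by simpa using ht₄, by simpa using ht₅, by simpa using ht₆, ?_⟩
        simp; omega
    · simp [hs'.1.1, add_mul]
  · simp [h₂.1]
  rintro s₃ ⟨h₃, hs₃, hT₃, hp₃, hacc, hd₃, -, hlast⟩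
  have hdD := hd _ hd₃
  have hTd : T ≤ p * s₃.reg .d := by
    by_contra! hlt
    rw [hlast (by omega)] at hlt
    omega
  refine Runs.block_singleton (Runs.mono (Runs.for_add (fun s' => s'.reg .votes = n)
    (r := .shift) (fun _ => n) (M := s₃.reg .d) h₃.2.1 rfl (by omega) ?_) ?_)
  · intro u _ s' hs'
    exact Runs.block_set (Runs.block_nil (by simpa using hs'))
  · rintro s' ⟨-, h⟩
    refine ⟨s₃.reg .d, hdD, ?_, hTd⟩
    rw [h, hs₃, sum_const, card_range, smul_eq_mul, zero_add, mul_comm]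

/-- Only the upper bound for `pow[a]` matters for the number of iterations in `fillTable`. -/
theorem powersOfTwo_runs (hm : m ≤ N) (hs : s.reg .cands = m)
    (hpow : ∀ a, s.arr .pow a 0 0 = 0) :
    Runs N powersOfTwo s fun s' => ∀ a, s'.arr .pow a 0 0 ≤ 2 ^ a := by
  refine Runs.mono (R := fun s' => s'.reg .cands = m ∧ ∀ a, s'.arr .pow a 0 0 ≤ 2 ^ a)
    (Cmd.Preserves.runs ?_ ?_) fun _ h => h.2
  · simp [powersOfTwo, Cmd.for, Cmd.block, Cmd.Preserves, wr1, rd1]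
    refine ⟨fun s hs h => ⟨hs, fun a => ?_⟩, fun s hs _ => hs ▸ hm, fun s hs h => ⟨hs, fun a => ?_⟩⟩
    · split
      · subst_vars; simp
      · exact h a
    · split
      · subst_vars
        have := h (s.reg .a)
        rw [pow_succ]; omega
      · exact h a
  · exact ⟨hs, by simp [hpow]⟩

/-- `size[i]` is at most the number of the alternatives that are allowed at position `i`. -/
theorem allowedSets_runs {K h : ℕ} {S : ℕ → ℕ} (hm : m ≤ N) (hs : s.reg .cands = m)
    (hn : s.reg .votes = n) (hh : s.reg .shift = h) (hS : ∀ a, s.arr .sum a 0 0 = S a)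
    (hsize : ∀ i, s.arr .size i 0 0 = 0)
    (hK : ∀ i < m, #{a ∈ range m | n * i < S a + h ∧ S a < n * i + h} ≤ K) :
    Runs N allowedSets s fun s' => ∀ i, s'.arr .size i 0 0 ≤ K := by
  let I : ℕ → Store Reg Arr → Prop := fun i s' => s'.reg .cands = m ∧ s'.reg .votes = n ∧
    s'.reg .shift = h ∧ (∀ a, s'.arr .sum a 0 0 = S a) ∧ s'.reg .scaled = n * i
  refine Runs.block_set <| Runs.block_singleton <| Runs.for (fun i s' => I i s' ∧
    (∀ j, s'.arr .size j 0 0 ≤ K) ∧ ∀ j, i ≤ j → s'.arr .size j 0 0 = 0) ?_ (by simp [hs, hm]) ?_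
    fun _ h => h.2.1
  · simp [I, hs, hn, hh, hS, hsize]
  · rintro i hi s' ⟨hI, h₁, h₂⟩
    have him : i < m := by simpa [hs] using hi
    let J : ℕ → Store Reg Arr → Prop := fun v t => I i t ∧ t.reg .i = i ∧
      (∀ j, j ≠ i → t.arr .size j 0 0 = s'.arr .size j 0 0) ∧
      t.arr .size i 0 0 ≤ #{a ∈ range v | n * i < S a + h ∧ S a < n * i + h}
    refine Runs.block_cons (Runs.for J ?_ (by simp [hI.1, hm]) ?_ fun _ h => h) ?_
    · simp [J, h₂ i le_rfl]
      simpa [I] using hI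
    · rintro a - t ⟨ht, hti, ht₁, ht₂⟩
      refine Runs.block_cons (R := fun t => J (a + 1) t) (Runs.when (fun hc => Runs.block_put <|
        Runs.block_put <| Runs.block_put <| Runs.block_nil ?_) (fun hc => ?_)) ?_
      · simp [Test.eval, rd1, ht.2.2.1, ht.2.2.2.1, ht.2.2.2.2] at hc
        refine ⟨by simpa [I] using ht, by simpa using hti, ?_, ?_⟩
        · intro j hj
          simp [hti, hj, ht₁ j hj]
        · simp [hti, rd1, range_add_one, filter_insert, hc, ht₂]
      · refine ⟨by simpa [I] using ht, by simpa using hti, by simpa using ht₁, ?_⟩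
        refine le_trans (by simpa using ht₂) (card_le_card (filter_subset_filter _ ?_))
        exact range_subset_range.2 (by omega)
      · intro t' ht'
        refine Runs.block_singleton (Runs.when (fun _ => Runs.block_put <| Runs.block_nil ?_)
          fun _ => ht')
        simpa [J, I] using ht'
    · rintro t ⟨ht, -, ht₁, ht₂⟩
      refine Runs.block_set (Runs.block_nil ⟨?_, ?_, ?_⟩)
      · simpa [I, mul_add, ht.2.1, ht.2.2.2.2] using ht
      · intro j
        by_cases hj : j = i
        · subst hj
          refine le_trans (by simpa using ht₂) (le_trans ?_ (hK j him))
          simp [hI.1]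
        · simpa [ht₁ j hj] using h₁ j
      · intro j hj
        simpa [ht₁ j (by omega)] using h₂ j (by omega)

/-- The invariant for filling the table: at most `K` alternatives are allowed at each position, and
`pow[a]` is at most `2 ^ a`. -/
def IsBounded (m K : ℕ) (s : Store Reg Arr) : Prop :=
  s.reg .cands = m ∧ s.reg .k ≤ K ∧ (∀ i, s.arr .size i 0 0 ≤ K) ∧ ∀ a, s.arr .pow a 0 0 ≤ 2 ^ a

theorem IsBounded.setReg {K v : ℕ} {r : Reg} (h : IsBounded m K s) (h₁ : r ≠ .cands)
    (h₂ : r ≠ .k) : IsBounded m K (s.setReg r v) := by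
  simpa [IsBounded, h₁.symm, h₂.symm] using h

theorem IsBounded.setArr {K i j k v : ℕ} {r : Arr} (h : IsBounded m K s) (h₁ : r ≠ .size)
    (h₂ : r ≠ .pow) : IsBounded m K (s.setArr r i j k v) := by
  simpa [IsBounded, h₁.symm, h₂.symm] using h

theorem IsBounded.setReg_k {K : ℕ} (h : IsBounded m K s) (e : E) :
    IsBounded m K (s.setReg .k ((rd1 .size e).eval s)) := by
  simpa [IsBounded] using ⟨h.1, h.2.2.1 _, h.2.2⟩

theorem fillTable_preserves {K : ℕ} (hm : m ≤ N) (hK : 2 ^ K ≤ N) :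
    fillTable.Preserves (IsBounded m K) N := by
  have hKN : K ≤ N := K.lt_two_pow_self.le.trans hK
  simp only [fillTable, computeEntry, minimizePrevious, addPartialScore, nextSubset, Cmd.for,
    Cmd.when, Cmd.block, Cmd.Preserves, wr1, wr3, incr]
  repeat' apply And.intro
  all_goals first
    | exact trivial
    | exact fun s h => h.setReg (by decide) (by decide)
    | exact fun s v h => h.setReg (by decide) (by decide)
    | exact fun s h => h.setArr (by decide) (by decide)
    | exact fun s h => h.setReg_k _
    | exact fun s h => h.1.trans_le hm
    | exact fun s h => h.2.1.trans hKN
    | exact fun s h => (h.2.2.1 _).trans hKN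
    | exact fun s h => (h.2.2.2 _).trans ((Nat.pow_le_pow_right two_pos h.2.1).trans hK)

theorem traceBack_preserves {K : ℕ} (hm : m ≤ N) (hK : 2 ^ K ≤ N) :
    traceBack.Preserves (IsBounded m K) N := by
  have hKN : K ≤ N := K.lt_two_pow_self.le.trans hK
  simp only [traceBack, Cmd.for, Cmd.when, Cmd.block, Cmd.Preserves, wr1]
  repeat' apply And.intro
  all_goals first
    | exact trivial
    | exact fun s h => h.setReg (by decide) (by decide)
    | exact fun s v h => h.setReg (by decide) (by decide)
    | exact fun s h => h.setArr (by decide) (by decide)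
    | exact fun s h => h.setReg_k _
    | exact fun s h => h.1.trans_le hm
    | exact fun s h => h.2.1.trans hKN

/-- The running time is governed by the bound `D` for the rounded average distance and the
bound `K` for the number of alternatives that are allowed at a position. -/
theorem program_runs {D K : ℕ} (hm : m ≤ N) (hn : n ≤ N) (hD : D ≤ N) (hK : 2 ^ K ≤ N)
    (hs : HasInput m n x s) (harr : ∀ r, r ≠ .pos → s.arr r = fun _ _ _ => 0)
    (hreg : ∀ r, r ≠ .cands → r ≠ .votes → s.reg r = 0)
    (hd : ∀ d, d ≤ 1 ∨ n * (n - 1) * (d - 1) < ∑ u ∈ range n, ∑ v ∈ range n, inversions m x u v →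
      d ≤ D)
    (hsize : ∀ d ≤ D, ∑ u ∈ range n, ∑ v ∈ range n, inversions m x u v ≤ n * (n - 1) * d →
      ∀ i < m, #{a ∈ range m | n * i < ∑ u ∈ range n, x u a + n * d ∧
        ∑ u ∈ range n, x u a < n * i + n * d} ≤ K) :
    (program.exec s).2 ≤ program.bound N := by
  have key₁ := countVotes_runs hm hn hs (by simp [harr])
  have k₁ : ∀ r ∈ [Reg.total, .pairs, .shift, .k], (countVotes.exec s).1.reg r = 0 := by
    intro r hr
    rw [Cmd.KeepsReg.exec, hreg]
    all_goals fin_cases hr <;>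
      simp [countVotes, Cmd.for, Cmd.when, Cmd.block, Cmd.KeepsReg, wr1, wr2]
  have a₁ : ∀ r ∈ [Arr.pow, .size], (countVotes.exec s).1.arr r = fun _ _ _ => 0 := by
    intro r hr
    rw [Cmd.KeepsArr.exec, harr]
    all_goals fin_cases hr <;>
      simp [countVotes, Cmd.for, Cmd.when, Cmd.block, Cmd.KeepsArr, wr1, wr2]
  generalize ht₁ : (countVotes.exec s).1 = s₁ at k₁ a₁
  obtain ⟨⟨h₁, hS₁⟩, c₁⟩ := key₁
  rw [ht₁] at h₁ hS₁
  obtain ⟨⟨d, hdD, hsh, hT⟩, c₂⟩ := averageDistance_runs hm hn hD h₁ hd (k₁ _ (by simp))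
    (k₁ _ (by simp)) (k₁ _ (by simp))
  have k₂ : ∀ r ∈ [Reg.cands, .votes, .k],
      (averageDistance.exec s₁).1.reg r = s₁.reg r := by
    intro r hr
    rw [Cmd.KeepsReg.exec]
    fin_cases hr <;> simp [averageDistance, Cmd.for, Cmd.when, Cmd.block, Cmd.KeepsReg, incr]
  have a₂ : ∀ r, (averageDistance.exec s₁).1.arr r = s₁.arr r := by
    intro r
    rw [Cmd.KeepsArr.exec]
    simp [averageDistance, Cmd.for, Cmd.when, Cmd.block, Cmd.KeepsArr, incr]
  generalize ht₂ : (averageDistance.exec s₁).1 = s₂ at k₂ a₂ hsh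
  obtain ⟨hp₃, c₃⟩ := powersOfTwo_runs (N := N) (s := s₂) hm
    ((k₂ _ (by simp)).trans h₁.1) (fun a => by rw [a₂, a₁ _ (by simp)])
  have k₃ : ∀ r, r ≠ .a → (powersOfTwo.exec s₂).1.reg r = s₂.reg r := by
    intro r hr
    rw [Cmd.KeepsReg.exec]
    simp [powersOfTwo, Cmd.for, Cmd.block, Cmd.KeepsReg, wr1, hr]
  have a₃ : ∀ r, r ≠ .pow → (powersOfTwo.exec s₂).1.arr r = s₂.arr r := by
    intro r hr
    rw [Cmd.KeepsArr.exec]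
    simp [powersOfTwo, Cmd.for, Cmd.block, Cmd.KeepsArr, wr1, hr]
  generalize ht₃ : (powersOfTwo.exec s₂).1 = s₃ at k₃ a₃ hp₃
  obtain ⟨hz₄, c₄⟩ := allowedSets_runs (N := N) (s := s₃) (m := m) (n := n) (h := n * d) (K := K)
    (S := fun a => if a < m then ∑ u ∈ range n, x u a else 0) hm
    (by rw [k₃ _ (by simp), k₂ _ (by simp), h₁.1]) (by rw [k₃ _ (by simp), k₂ _ (by simp), h₁.2.1])
    (by rw [k₃ _ (by simp), hsh]) (fun a => by rw [a₃ _ (by simp), a₂, hS₁])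
    (fun i => by rw [a₃ _ (by simp), a₂, a₁ _ (by simp)]) (fun i hi => by
      convert hsize d hdD hT i hi using 2
      refine filter_congr fun a ha => ?_
      rw [if_pos (mem_range.1 ha)])
  have k₄ : ∀ r ∈ [Reg.cands, .k], (allowedSets.exec s₃).1.reg r = s₃.reg r := by
    intro r hr
    rw [Cmd.KeepsReg.exec]
    fin_cases hr <;>
      simp [allowedSets, Cmd.for, Cmd.when, Cmd.block, Cmd.KeepsReg, incr, wr1, wr2]
  have a₄ : (allowedSets.exec s₃).1.arr .pow = s₃.arr .pow := by
    rw [Cmd.KeepsArr.exec]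
    simp [allowedSets, Cmd.for, Cmd.when, Cmd.block, Cmd.KeepsArr, incr, wr1, wr2]
  generalize ht₄ : (allowedSets.exec s₃).1 = s₄ at k₄ a₄ hz₄
  have h₄ : IsBounded m K s₄ := by
    refine ⟨?_, ?_, hz₄, fun a => ?_⟩
    · rw [k₄ _ (by simp), k₃ _ (by simp), k₂ _ (by simp), h₁.1]
    · rw [k₄ _ (by simp), k₃ _ (by simp), k₂ _ (by simp), k₁ _ (by simp)]
      exact Nat.zero_le _
    · rw [a₄]; exact hp₃ a
  obtain ⟨h₅, c₅⟩ := (fillTable_preserves hm hK).runs h₄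
  obtain ⟨-, c₆⟩ := (traceBack_preserves hm hK).runs h₅
  simp only [program, Cmd.block, Cmd.exec, Cmd.bound, ht₁, ht₂, ht₃, ht₄]
  exact add_le_add c₁ (add_le_add c₂ (add_le_add c₃ (add_le_add c₄ (add_le_add c₅
    (add_le_add c₆ le_rfl)))))

end steps
end Kemeny

/-! ### The number of alternatives allowed at a position -/

section footrule

open Finset

variable {m n : ℕ}

/-- The position of an alternative counts the alternatives above it. -/
theorem Ranking.val_eq_card (R : Ranking m) (a : Fin m) : (R a : ℕ) = #{b | R b < R a} := by
  rw [← Fin.card_Iio, ← card_map R.toEmbedding (s := {b | R b < R a})]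
  congr 1
  ext b
  simp [mem_map_equiv]

theorem Ranking.val_le (R W : Ranking m) (a : Fin m) :
    (R a : ℕ) ≤ W a + #{b | R b < R a ∧ W a < W b} := by
  rw [R.val_eq_card, W.val_eq_card]
  refine (card_le_card fun b hb => ?_).trans (card_union_le _ _)
  simp only [mem_filter, mem_univ, true_and, mem_union] at hb ⊢
  have hab : W b ≠ W a := fun h => hb.ne (by rw [W.injective h])
  rcases lt_or_gt_of_ne hab with h | h
  · exact .inl h
  · exact .inr ⟨hb, h⟩

theorem kendallTau_eq_sum (R W : Ranking m) :
    kendallTau R W = ∑ a, ∑ b, if R a < R b ∧ W b < W a then 1 else 0 := by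
  rw [kendallTau, card_filter, Fintype.sum_prod_type]

theorem kendallTau_comm (R W : Ranking m) : kendallTau R W = kendallTau W R := by
  rw [kendallTau_eq_sum, kendallTau_eq_sum, sum_comm]
  simp only [and_comm]

@[simp] theorem kendallTau_self (R : Ranking m) : kendallTau R R = 0 := by
  rw [kendallTau, card_eq_zero, filter_eq_empty_iff]
  exact fun p _ h => lt_asymm h.1 h.2

theorem kendallTau_triangle (R V W : Ranking m) :
    kendallTau R W ≤ kendallTau R V + kendallTau V W := by
  refine (card_le_card fun p hp => ?_).trans (card_union_le _ _)
  simp only [mem_filter, mem_univ, true_and, mem_union] at hp ⊢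
  have hne : V p.1 ≠ V p.2 := fun h => hp.1.ne (by rw [V.injective h])
  rcases lt_or_gt_of_ne hne with h | h
  · exact .inr ⟨h, hp.2⟩
  · exact .inl ⟨hp.1, h⟩

theorem kendallTau_le (R W : Ranking m) : kendallTau R W ≤ m * (m - 1) := by
  calc kendallTau R W ≤ #(univ : Finset (Fin m)).offDiag := by
        refine card_le_card fun p hp => ?_
        simp only [mem_filter, mem_univ, true_and, mem_offDiag] at hp ⊢
        exact fun h => hp.1.ne (by rw [h])
    _ = m * (m - 1) := by simp [offDiag_card, Nat.mul_sub]

/-- Spearman's footrule is at most twice the Kendall-tau distance. -/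
theorem footrule_le (R W : Ranking m) :
    ∑ a, |((R a : ℕ) : ℤ) - ((W a : ℕ) : ℤ)| ≤ 2 * kendallTau R W := by
  have h : ∀ a, |((R a : ℕ) : ℤ) - ((W a : ℕ) : ℤ)| ≤
      (#{b | R b < R a ∧ W a < W b} + #{b | W b < W a ∧ R a < R b} : ℕ) := by
    intro a
    have h₁ := R.val_le W a
    have h₂ := W.val_le R a
    rw [abs_le]
    constructor <;> omega
  refine (sum_le_sum fun a _ => h a).trans (le_of_eq ?_)
  rw [two_mul, ← Nat.cast_sum, sum_add_distrib, ← Nat.cast_add]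
  congr 2
  · rw [kendallTau_comm, kendallTau_eq_sum]
    exact sum_congr rfl fun a _ => by rw [card_filter]; simp only [and_comm]
  · rw [kendallTau_eq_sum]
    exact sum_congr rfl fun a _ => by rw [card_filter]; simp only [and_comm]

/-- Few alternatives of a set `A` lie close to `i`, so that their distances from `i` add up. -/
theorem le_sum_abs_sub (R : Ranking m) (A : Finset (Fin m)) (i d : ℕ) :
    (2 * d * (#A - 4 * d) : ℤ) ≤ ∑ a ∈ A, |((R a : ℕ) : ℤ) - i| := by
  have hclose : #{a ∈ A | |((R a : ℕ) : ℤ) - i| < 2 * d} ≤ 4 * d := by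
    calc _ = #(({a ∈ A | |((R a : ℕ) : ℤ) - i| < 2 * d}).image fun a => ((R a : ℕ) : ℤ)) := by
          rw [card_image_of_injective]
          intro a b h
          exact R.injective (Fin.ext (Int.ofNat_inj.1 h))
      _ ≤ #(Ioo ((i : ℤ) - 2 * d) (i + 2 * d)) := by
          refine card_le_card fun y hy => ?_
          simp only [mem_image, mem_filter] at hy
          obtain ⟨a, ⟨-, h⟩, rfl⟩ := hy
          rw [abs_lt] at h
          rw [mem_Ioo]
          constructor <;> linarith [h.1, h.2]
      _ ≤ 4 * d := by rw [Int.card_Ioo]; omega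
  have hcard := card_filter_add_card_filter_not (s := A) fun a => |((R a : ℕ) : ℤ) - i| < 2 * d
  calc (2 * d * (#A - 4 * d) : ℤ)
      ≤ #{a ∈ A | ¬ |((R a : ℕ) : ℤ) - i| < 2 * d} * (2 * d) := by
        rw [mul_comm]
        refine mul_le_mul_of_nonneg_right ?_ (by positivity)
        omega
    _ ≤ ∑ a ∈ A with ¬ |((R a : ℕ) : ℤ) - i| < 2 * d, |((R a : ℕ) : ℤ) - i| := by
        rw [← nsmul_eq_mul]
        exact card_nsmul_le_sum _ _ _ fun a ha => not_lt.1 (mem_filter.1 ha).2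
    _ ≤ _ := sum_le_sum_of_subset_of_nonneg (filter_subset _ _) fun a _ _ => abs_nonneg _

/-- At most `10 d` alternatives have an average position at distance less than `d` from `i`,
if the average distance of the votes is at most `d`: on average over the votes, alternatives deviate
from their average position by at most `2 d` in total, but the positions of `k` alternatives in a
vote have total distance of the order `k ^ 2` from `i`. -/
theorem card_allowed_le (P : Profile m n) (i d : ℕ)
    (hP : ∑ u, ∑ v, kendallTau (P u) (P v) ≤ n * (n - 1) * d) :
    #{a | n * i < ∑ u, (P u a : ℕ) + n * d ∧ ∑ u, (P u a : ℕ) < n * i + n * d} ≤ 10 * d := by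
  set A : Finset (Fin m) :=
    {a | n * i < ∑ u, (P u a : ℕ) + n * d ∧ ∑ u, (P u a : ℕ) < n * i + n * d} with hA
  rcases A.eq_empty_or_nonempty with h0 | ⟨a₀, ha₀⟩
  · simp [h0]
  have hnd : 0 < n * d := by have := (mem_filter.1 ha₀).2; omega
  have hn : 0 < n := Nat.pos_of_mul_pos_right hnd
  have hd : 0 < d := Nat.pos_of_mul_pos_left hnd
  have hlow : (n : ℤ) * (2 * d * (#A - 4 * d)) ≤ ∑ u, ∑ a ∈ A, |((P u a : ℕ) : ℤ) - i| := by
    simpa using sum_le_sum fun u (_ : u ∈ univ) => le_sum_abs_sub (P u) A i d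
  have hup : ∀ a ∈ A, (n : ℤ) * ∑ u, |((P u a : ℕ) : ℤ) - i| ≤
      ∑ u, ∑ v, |((P u a : ℕ) : ℤ) - (P v a : ℕ)| + n * (n * d) := by
    intro a ha
    have ha := (mem_filter.1 ha).2
    have h₁ : ∀ u, (n : ℤ) * |((P u a : ℕ) : ℤ) - i| ≤
        ∑ v, |((P u a : ℕ) : ℤ) - (P v a : ℕ)| + n * d := by
      intro u
      calc (n : ℤ) * |((P u a : ℕ) : ℤ) - i| = |(n : ℤ) * (((P u a : ℕ) : ℤ) - i)| := by
            rw [abs_mul, Nat.abs_cast]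
        _ = |∑ v, (((P u a : ℕ) : ℤ) - (P v a : ℕ)) + (∑ v, ((P v a : ℕ) : ℤ) - n * i)| := by
            rw [sum_sub_distrib]
            simp only [sum_const, card_univ, Fintype.card_fin, nsmul_eq_mul]
            congr 1; ring
        _ ≤ |∑ v, (((P u a : ℕ) : ℤ) - (P v a : ℕ))| + |∑ v, ((P v a : ℕ) : ℤ) - n * i| :=
            abs_add_le _ _
        _ ≤ _ := by
            refine add_le_add (abs_sum_le_sum_abs _ _) ?_
            rw [abs_le]
            zify at ha
            constructor <;> linarith [ha.1, ha.2]
    calc (n : ℤ) * ∑ u, |((P u a : ℕ) : ℤ) - i| = ∑ u, (n : ℤ) * |((P u a : ℕ) : ℤ) - i| :=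
          mul_sum _ _ _
      _ ≤ ∑ u, (∑ v, |((P u a : ℕ) : ℤ) - (P v a : ℕ)| + n * d) := sum_le_sum fun u _ => h₁ u
      _ = _ := by rw [sum_add_distrib]; simp
  have hfoot : ∑ a ∈ A, ∑ u, ∑ v, |((P u a : ℕ) : ℤ) - (P v a : ℕ)| ≤ 2 * (n * n * d) := by
    calc _ ≤ ∑ a, ∑ u, ∑ v, |((P u a : ℕ) : ℤ) - (P v a : ℕ)| :=
          sum_le_sum_of_subset_of_nonneg (subset_univ _) fun a _ _ =>
            sum_nonneg fun u _ => sum_nonneg fun v _ => abs_nonneg _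
      _ = ∑ u, ∑ v, ∑ a, |((P u a : ℕ) : ℤ) - (P v a : ℕ)| := by
          rw [sum_comm]
          exact sum_congr rfl fun u _ => sum_comm
      _ ≤ ∑ u, ∑ v, 2 * (kendallTau (P u) (P v) : ℤ) :=
          sum_le_sum fun u _ => sum_le_sum fun v _ => footrule_le _ _
      _ = 2 * ((∑ u, ∑ v, kendallTau (P u) (P v) : ℕ) : ℤ) := by
          simp only [← mul_sum, Nat.cast_sum]
      _ ≤ 2 * ((n * n * d : ℕ) : ℤ) := by
          have : n * (n - 1) * d ≤ n * n * d := by gcongr; omega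
          exact mul_le_mul_of_nonneg_left (by exact_mod_cast hP.trans this) (by norm_num)
      _ = _ := by push_cast; rfl
  have hall : (n : ℤ) * (n * (2 * d * (#A - 4 * d))) ≤ 2 * (n * n * d) + #A * (n * (n * d)) := by
    calc _ ≤ (n : ℤ) * ∑ u, ∑ a ∈ A, |((P u a : ℕ) : ℤ) - i| :=
          mul_le_mul_of_nonneg_left hlow (by positivity)
      _ = ∑ a ∈ A, (n : ℤ) * ∑ u, |((P u a : ℕ) : ℤ) - i| := by rw [sum_comm, mul_sum]
      _ ≤ ∑ a ∈ A, (∑ u, ∑ v, |((P u a : ℕ) : ℤ) - (P v a : ℕ)| + n * (n * d)) :=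
          sum_le_sum hup
      _ ≤ _ := by rw [sum_add_distrib, sum_const, nsmul_eq_mul]; linarith
  have hpos : (0 : ℤ) < n * n * d := by positivity
  have : (2 * (#A - 4 * d) : ℤ) ≤ 2 + #A := by
    refine le_of_mul_le_mul_left ?_ hpos
    calc _ = (n : ℤ) * (n * (2 * d * (#A - 4 * d))) := by ring
      _ ≤ _ := hall
      _ = _ := by ring
  omega

end footrule

/-! ### The running time in terms of the average distance -/

namespace Kemeny

open RAM Finset

variable {m n : ℕ}

theorem avgKendallTau_nonneg (P : Profile m n) : 0 ≤ avgKendallTau P := by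
  unfold avgKendallTau
  rcases Nat.eq_zero_or_pos n with rfl | hn
  · simp
  have : (1 : ℝ) ≤ n := by exact_mod_cast hn
  exact div_nonneg (by positivity) (mul_nonneg (by linarith) (by linarith))

theorem inversions_load (P : Profile m n) (u v : Fin n) :
    inversions m (fun u a => (load P).arr .pos u a 0) u v = kendallTau (P u) (P v) := by
  rw [kendallTau_eq_sum, inversions, sum_range]
  refine sum_congr rfl fun a _ => ?_
  rw [sum_range]
  exact sum_congr rfl fun b _ => by simp [load]

/-- With the rounded average distance `D`, at most `10 D` alternatives are allowed at each position,
and `m n 2 ^ (10 D)` bounds the number of iterations of every loop. -/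
theorem exists_runtime_le_nat : ∃ C B : ℕ, 1 ≤ C ∧ ∀ (m n : ℕ) (P : Profile m n), 0 < m → 0 < n →
    runtime P ≤ C * (m * n * 2 ^ (10 * max 1 ⌈avgKendallTau P⌉₊)) ^ B := by
  refine ⟨program.bound 1, program.depth, by simp [program, Cmd.block, Cmd.bound]; omega, ?_⟩
  intro m n P hm hn
  set D : ℕ := max 1 ⌈avgKendallTau P⌉₊ with hDdef
  set x : ℕ → ℕ → ℕ := fun u a => (load P).arr .pos u a 0 with hx
  have htotal : ∑ u ∈ range n, ∑ v ∈ range n, inversions m x u v =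
      ∑ u, ∑ v, kendallTau (P u) (P v) := by
    rw [sum_range]
    refine sum_congr rfl fun u _ => ?_
    rw [sum_range]
    exact sum_congr rfl fun v _ => inversions_load P u v
  have hsum : ∀ a : Fin m, ∑ u ∈ range n, x u a = ∑ u, (P u a : ℕ) := by
    intro a
    rw [sum_range]
    exact sum_congr rfl fun u _ => by simp [hx, load]
  have hmn : 1 ≤ m * n := Nat.mul_pos hm hn
  have h2 : 1 ≤ 2 ^ (10 * D) := Nat.one_le_two_pow
  have hsteps := program_runs (m := m) (n := n) (N := m * n * 2 ^ (10 * D)) (x := x)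
    (s := load P) (D := D) (K := 10 * D)
    (by rw [mul_assoc]; exact Nat.le_mul_of_pos_right _ (Nat.mul_pos hn h2))
    (by rw [mul_comm m, mul_assoc]; exact Nat.le_mul_of_pos_right _ (Nat.mul_pos hm h2))
    ((show D ≤ 10 * D by omega).trans (Nat.lt_two_pow_self.le.trans
      (Nat.le_mul_of_pos_left _ hmn)))
    (Nat.le_mul_of_pos_left _ hmn)
    ⟨rfl, rfl, fun _ _ => rfl⟩
    (fun r hr => by cases r <;> first | rfl | exact absurd rfl hr)
    (fun r h₁ h₂ => by cases r <;> first | rfl | exact absurd rfl h₁ | exact absurd rfl h₂)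
    (fun d hd => ?_) (fun d hd hT i hi => ?_)
  · exact hsteps.trans (Cmd.bound_le _ (Nat.mul_pos hmn h2))
  · rw [htotal] at hd
    rcases hd with hd | hd
    · exact hd.trans (le_max_left _ _)
    · refine le_max_of_le_right ?_
      suffices d - 1 < ⌈avgKendallTau P⌉₊ by omega
      rw [Nat.lt_ceil]
      unfold avgKendallTau
      have hpos : 0 < n * (n - 1) := by
        rw [Nat.pos_iff_ne_zero]
        intro h0
        obtain rfl : n = 1 := by
          rcases Nat.mul_eq_zero.1 h0 with h | h <;> omega
        simp at hd
      have hn1 : ((n - 1 : ℕ) : ℝ) = (n : ℝ) - 1 := by rw [Nat.cast_sub hn]; simp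
      rw [lt_div_iff₀ (by rw [← hn1]; exact_mod_cast hpos), ← hn1, mul_comm]
      exact_mod_cast hd
  · rw [htotal] at hT
    refine le_trans (le_of_eq ?_) ((card_allowed_le P i d hT).trans (Nat.mul_le_mul_left _ hd))
    rw [card_filter, card_filter, sum_range]
    exact sum_congr rfl fun a _ => by rw [hsum]

/-- The algorithm runs in time polynomial in `m n` and exponential in the average distance. -/
theorem exists_runtime_le : ∃ C B : ℕ, 1 ≤ C ∧ ∀ (m n : ℕ) (P : Profile m n), 0 < m → 0 < n →
    (runtime P : ℝ) ≤ C * ((m * n : ℕ) : ℝ) ^ B * 2 ^ (10 * B * (avgKendallTau P + 1)) := by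
  obtain ⟨C, B, hC, h⟩ := exists_runtime_le_nat
  refine ⟨C, B, hC, fun m n P hm hn => ?_⟩
  replace h := h m n P hm hn
  have hD : ((max 1 ⌈avgKendallTau P⌉₊ : ℕ) : ℝ) ≤ avgKendallTau P + 1 := by
    rw [Nat.cast_max, max_le_iff]
    exact ⟨by simpa using avgKendallTau_nonneg P,
      (Nat.ceil_lt_add_one (avgKendallTau_nonneg P)).le⟩
  generalize max 1 ⌈avgKendallTau P⌉₊ = D at h hD
  calc (runtime P : ℝ) ≤ ((C * (m * n * 2 ^ (10 * D)) ^ B : ℕ) : ℝ) := by exact_mod_cast h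
    _ = C * ((m * n : ℕ) : ℝ) ^ B * (2 : ℝ) ^ (10 * B * (D : ℝ)) := by
      rw [show (10 * B * (D : ℝ)) = ((10 * D * B : ℕ) : ℝ) by push_cast; ring, Real.rpow_natCast]
      push_cast
      rw [mul_pow, ← pow_mul]
      ring
    _ ≤ _ := by
      gcongr
      norm_num

end Kemeny

/-! ### The Mallows model -/

section mallows

open Finset MeasureTheory ProbabilityTheory

variable {m n : ℕ}

/-- Exchanging two alternatives that `W` orders differently from `R` brings `W` closer to `R`. -/
theorem kendallTau_swap_lt (R W : Ranking m) {a b : Fin m} (hR : R a < R b) (hW : W b < W a) :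
    kendallTau R (W * Equiv.swap a b) < kendallTau R W := by
  set σ := Equiv.swap a b with hσ
  have hσσ : ∀ c, σ (σ c) = c := Equiv.swap_apply_self a b
  have hmem : (a, b) ∈ ({p : Fin m × Fin m | R p.1 < R p.2 ∧ W p.2 < W p.1} : Finset _) := by
    simp [hR, hW]
  -- an inversion of `W * σ` is sent to its image under `σ` if `R` orders this image in the same way
  let f : Fin m × Fin m → Fin m × Fin m := fun p =>
    if R (σ p.1) < R (σ p.2) then (σ p.1, σ p.2) else p
  unfold kendallTau
  refine lt_of_le_of_lt (card_le_card_of_injOn f ?_ ?_) (card_erase_lt_of_mem hmem)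
  · rintro ⟨p, q⟩ hpq
    replace hpq : R p < R q ∧ W (σ q) < W (σ p) := (mem_filter.1 hpq).2
    rw [mem_coe, mem_erase, mem_filter]
    simp only [mem_univ, true_and, f, ne_eq]
    split
    · rename_i h
      refine ⟨fun h' => ?_, h, hpq.2⟩
      simp only [Prod.mk.injEq] at h'
      have h₁ : p = b := by rw [← hσσ p, h'.1, hσ, Equiv.swap_apply_left]
      have h₂ : q = a := by rw [← hσσ q, h'.2, hσ, Equiv.swap_apply_right]
      subst h₁ h₂
      exact lt_asymm hR hpq.1
    · rename_i h
      rw [hσ, Equiv.swap_apply_def, Equiv.swap_apply_def] at h hpq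
      simp only [Prod.mk.injEq]
      grind
  · rintro ⟨p, q⟩ hpq ⟨p', q'⟩ hpq' h
    replace hpq : R p < R q := (mem_filter.1 hpq).2.1
    replace hpq' : R p' < R q' := (mem_filter.1 hpq').2.1
    simp only [f] at h
    grind

/-- In the Mallows model, a given pair of alternatives is inverted with probability at most `φ`. -/
theorem sum_inverted_le (R : Ranking m) {φ : ℝ} (h₀ : 0 < φ) (h₁ : φ ≤ 1) {a b : Fin m}
    (hR : R a < R b) :
    ∑ W : Ranking m with W b < W a, φ ^ kendallTau R W ≤ φ * mallowsZ R φ := by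
  calc ∑ W : Ranking m with W b < W a, φ ^ kendallTau R W
      ≤ ∑ W : Ranking m with W b < W a, φ * φ ^ kendallTau R (W * Equiv.swap a b) := by
        refine sum_le_sum fun W hW => ?_
        rw [← pow_succ']
        exact pow_le_pow_of_le_one h₀.le h₁ (kendallTau_swap_lt R W hR (mem_filter.1 hW).2)
    _ ≤ ∑ W : Ranking m, φ * φ ^ kendallTau R (W * Equiv.swap a b) :=
        sum_le_sum_of_subset_of_nonneg (filter_subset _ _) fun W _ _ => by positivity
    _ = φ * mallowsZ R φ := by
        rw [← mul_sum, mallowsZ]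
        congr 1
        exact Equiv.sum_comp (Equiv.mulRight (Equiv.swap a b)) fun W => φ ^ kendallTau R W

theorem sum_kendallTau_mul_le (R : Ranking m) {φ : ℝ} (h₀ : 0 < φ) (h₁ : φ ≤ 1) :
    ∑ W : Ranking m, (kendallTau R W : ℝ) * φ ^ kendallTau R W ≤
      (m : ℝ) ^ 2 * (φ * mallowsZ R φ) := by
  have hZ : 0 ≤ φ * mallowsZ R φ :=
    mul_nonneg h₀.le (sum_nonneg fun W _ => by positivity)
  calc ∑ W : Ranking m, (kendallTau R W : ℝ) * φ ^ kendallTau R W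
      = ∑ a, ∑ b, ∑ W : Ranking m,
          if R a < R b ∧ W b < W a then φ ^ kendallTau R W else 0 := by
        rw [sum_congr rfl fun a _ => sum_comm, sum_comm]
        refine sum_congr rfl fun W _ => ?_
        nth_rewrite 1 [kendallTau_eq_sum]
        push_cast
        rw [sum_mul]
        refine sum_congr rfl fun a _ => ?_
        rw [sum_mul]
        exact sum_congr rfl fun b _ => by split <;> simp
    _ ≤ ∑ a : Fin m, ∑ b : Fin m, φ * mallowsZ R φ := by
        refine sum_le_sum fun a _ => sum_le_sum fun b _ => ?_
        by_cases hR : R a < R b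
        · simp only [hR, true_and]
          rw [← sum_filter]
          exact sum_inverted_le R h₀ h₁ hR
        · simpa [hR] using hZ
    _ = _ := by simp [pow_two, mul_assoc]

instance (m : ℕ) : DiscreteMeasurableSpace (Ranking m) := ⟨fun _ => trivial⟩

/-- The expected distance from the central ranking in the Mallows model. -/
theorem integral_kendallTau_le (R : Ranking m) (φ : Set.Ioc (0 : ℝ) 1) :
    ∫ W, (kendallTau R W : ℝ) ∂(mallows R φ).toMeasure ≤ (m : ℝ) ^ 2 * φ := by
  have hφ : (0 : ℝ) < φ := φ.2.1
  have hZ : 0 < mallowsZ R φ :=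
    sum_pos (fun W _ => pow_pos hφ _) univ_nonempty
  rw [PMF.integral_eq_sum]
  calc ∑ W, ((mallows R φ) W).toReal • (kendallTau R W : ℝ)
      = (∑ W, (kendallTau R W : ℝ) * (φ : ℝ) ^ kendallTau R W) / mallowsZ R φ := by
        rw [sum_div]
        refine sum_congr rfl fun W _ => ?_
        rw [mallows, PMF.ofFintype_apply, ENNReal.toReal_ofReal (by positivity), smul_eq_mul]
        ring
    _ ≤ _ := by
        rw [div_le_iff₀ hZ, mul_assoc]
        exact sum_kendallTau_mul_le R hφ φ.2.2

instance (P : Profile m n) (φ : Fin n → Set.Ioc (0 : ℝ) 1) :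
    IsProbabilityMeasure (mallowsProfile P φ) := by
  unfold mallowsProfile; infer_instance

/-! ### Concentration of the average distance -/

/-- Hoeffding's inequality for the total distance from the central profile. -/
theorem mallowsProfile_sum_kendallTau_ge (P : Profile m n) (φ : Fin n → Set.Ioc (0 : ℝ) 1)
    {ε : ℝ} (hε : 0 ≤ ε) :
    (mallowsProfile P φ).real
        {P' | (m : ℝ) ^ 2 * ∑ j, (φ j : ℝ) + ε ≤ ∑ j, (kendallTau (P j) (P' j) : ℝ)} ≤
      Real.exp (-ε ^ 2 / (2 * (n * ((m : ℝ) * (m - 1) / 2) ^ 2))) := by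
  set μ := mallowsProfile P φ with hμ
  let X : Fin n → Profile m n → ℝ := fun j P' => (kendallTau (P j) (P' j) : ℝ)
  have hX : ∀ j, Measurable (X j) := fun j =>
    (Measurable.of_discrete (f := fun W : Ranking m => (kendallTau (P j) W : ℝ))).comp
      (measurable_pi_apply j)
  have hmean : ∀ j, μ[X j] ≤ (m : ℝ) ^ 2 * φ j := by
    intro j
    refine le_trans (le_of_eq ?_) (integral_kendallTau_le (P j) (φ j))
    exact integral_comp_eval (μ := fun j => (mallows (P j) (φ j)).toMeasure)
      (f := fun W : Ranking m => (kendallTau (P j) W : ℝ)) (by fun_prop)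
  have hsub : ∀ j ∈ (univ : Finset (Fin n)), HasSubgaussianMGF (fun P' => X j P' - μ[X j])
      ((‖(m : ℝ) * (m - 1) - 0‖₊ / 2) ^ 2) μ := by
    intro j _
    refine hasSubgaussianMGF_of_mem_Icc (hX j).aemeasurable (.of_forall fun P' => ?_)
    refine ⟨by positivity, ?_⟩
    have h := kendallTau_le (P j) (P' j)
    rcases Nat.eq_zero_or_pos m with rfl | hm
    · simpa [X] using h
    · have : ((m * (m - 1) : ℕ) : ℝ) = (m : ℝ) * (m - 1) := by
        rw [Nat.cast_mul, Nat.cast_sub hm, Nat.cast_one]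
      rw [← this]
      exact Nat.cast_le.2 h
  have hind : iIndepFun (fun j P' => X j P' - μ[X j]) μ :=
    iIndepFun_pi (X := fun j (W : Ranking m) => (kendallTau (P j) W : ℝ) - μ[X j])
      fun j => Measurable.of_discrete.aemeasurable
  refine (measureReal_mono fun P' hP' => ?_).trans
    ((HasSubgaussianMGF.measure_sum_ge_le_of_iIndepFun hind hsub hε).trans (le_of_eq ?_))
  · simp only [Set.mem_ofPred_eq] at hP' ⊢
    rw [sum_sub_distrib]
    have := sum_le_sum fun j (_ : j ∈ univ) => hmean j
    rw [← mul_sum] at this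
    simp only [X] at this ⊢
    linarith
  · congr 3
    rw [sum_const, card_univ, Fintype.card_fin, nsmul_eq_mul]
    push_cast
    rw [sub_zero, div_pow, div_pow, Real.norm_eq_abs, sq_abs]

/-- The average distance grows at most by twice the average distance from the central profile. -/
theorem avgKendallTau_le (P P' : Profile m n) :
    avgKendallTau P' ≤ avgKendallTau P + 2 / n * ∑ j, (kendallTau (P j) (P' j) : ℝ) := by
  rcases Nat.lt_or_ge n 2 with hn | hn
  · have h0 : ∀ Q : Profile m n, avgKendallTau Q = 0 := by
      intro Q
      unfold avgKendallTau
      interval_cases n <;> simp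
    rw [h0, h0, zero_add]
    positivity
  have hn' : (2 : ℝ) ≤ n := by exact_mod_cast hn
  have hpos : (0 : ℝ) < (n : ℝ) * (n - 1) := by nlinarith
  have hle : ∀ j j', (kendallTau (P' j) (P' j') : ℝ) ≤ kendallTau (P j) (P j') +
      if j = j' then 0 else ((kendallTau (P j) (P' j) : ℝ) + kendallTau (P j') (P' j')) := by
    intro j j'
    split
    · rename_i h
      subst h
      simp
    · have h₁ := kendallTau_triangle (P' j) (P j) (P' j')
      have h₂ := kendallTau_triangle (P j) (P j') (P' j')
      rw [kendallTau_comm (P' j) (P j)] at h₁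
      norm_cast
      omega
  have hsum : ∑ j, ∑ j', (if j = j' then 0 else
      ((kendallTau (P j) (P' j) : ℝ) + kendallTau (P j') (P' j'))) =
      2 * (n - 1) * ∑ j, (kendallTau (P j) (P' j) : ℝ) := by
    have : ∀ j j', (if j = j' then 0 else
        ((kendallTau (P j) (P' j) : ℝ) + kendallTau (P j') (P' j'))) =
        ((kendallTau (P j) (P' j) : ℝ) + kendallTau (P j') (P' j')) -
          if j = j' then 2 * (kendallTau (P j) (P' j) : ℝ) else 0 := by
      intro j j'
      split
      · rename_i h; subst h; ring
      · ring
    simp only [this, sum_sub_distrib, sum_add_distrib, sum_const, card_univ, Fintype.card_fin,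
      nsmul_eq_mul, sum_ite_eq, mem_univ, if_true, ← mul_sum]
    ring
  unfold avgKendallTau
  rw [div_add' _ _ _ hpos.ne', div_le_div_iff_of_pos_right hpos]
  calc ∑ j, ∑ j', (kendallTau (P' j) (P' j') : ℝ) ≤ _ :=
        sum_le_sum fun j _ => sum_le_sum fun j' _ => hle j j'
    _ = _ := by
        simp only [sum_add_distrib]
        rw [hsum]
        field_simp

/-- Concentration of the average distance: its deviation is sub-Gaussian, uniformly in `m`
and `n`, as soon as the number of votes is of the order `m ^ 4`. -/
theorem mallowsProfile_avgKendallTau_ge {c₀ : ℝ} (hc₀ : 0 < c₀) (hm : 2 ≤ m) (P : Profile m n)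
    (φ : Fin n → Set.Ioc (0 : ℝ) 1) (hn : c₀ * ((m : ℝ) ^ 2 * ((m : ℝ) - 1) ^ 2) ≤ n)
    {s : ℝ} (hs : 0 ≤ s) :
    (mallowsProfile P φ).real
        {P' | avgKendallTau P + 2 * (m : ℝ) ^ 2 * ((∑ j, (φ j : ℝ)) / n) + s ≤ avgKendallTau P'} ≤
      Real.exp (-(c₀ / 2 * s ^ 2)) := by
  have hm' : (2 : ℝ) ≤ m := by exact_mod_cast hm
  have hm1 : (0 : ℝ) < m - 1 := by linarith
  have hm0 : (0 : ℝ) < m := by linarith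
  have hn0 : (0 : ℝ) < n := lt_of_lt_of_le (by positivity) hn
  refine (measureReal_mono fun P' hP' => ?_).trans
    ((mallowsProfile_sum_kendallTau_ge P φ (ε := n * s / 2) (by positivity)).trans ?_)
  · simp only [Set.mem_ofPred_eq] at hP' ⊢
    have h := hP'.trans (avgKendallTau_le P P')
    have h' : (n : ℝ) / 2 * (2 * (m : ℝ) ^ 2 * ((∑ j, (φ j : ℝ)) / n) + s) ≤
        n / 2 * (2 / n * ∑ j, (kendallTau (P j) (P' j) : ℝ)) :=
      mul_le_mul_of_nonneg_left (by linarith) (by positivity)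
    field_simp at h'
    linarith
  · rw [Real.exp_le_exp, neg_div, neg_le_neg_iff, le_div_iff₀ (by positivity)]
    calc c₀ / 2 * s ^ 2 * (2 * (n * ((m : ℝ) * (m - 1) / 2) ^ 2))
        = (c₀ * ((m : ℝ) ^ 2 * ((m : ℝ) - 1) ^ 2)) * (n * s ^ 2 / 4) := by ring
      _ ≤ n * (n * s ^ 2 / 4) := by gcongr
      _ = _ := by ring

end mallows

/-- Since `2 ≤ e`, a power of `2` with logarithmic exponent is bounded by a power. -/
theorem two_rpow_mul_log_le (k : ℕ) {M : ℝ} (hM : 1 ≤ M) :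
    (2 : ℝ) ^ (k * Real.log M) ≤ M ^ k := by
  have hL := Real.log_nonneg hM
  calc (2 : ℝ) ^ (k * Real.log M) ≤ Real.exp 1 ^ (k * Real.log M) := by
        gcongr
        linarith [Real.add_one_le_exp 1]
    _ = M ^ k := by
        rw [Real.exp_one_rpow, mul_comm, Real.exp_mul, Real.exp_log (by linarith),
          Real.rpow_natCast]

namespace Kemeny

variable {m n : ℕ}

/-- If the average distance is at most `K log (m n) + s`, the running time is at most the product
of a polynomial in `m n` and an exponential in `s`. -/
theorem exists_runtime_le_of_avgKendallTau_le (K : ℝ) :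
    ∃ A B D : ℕ, 1 ≤ A ∧ ∀ (m n : ℕ) (P : Profile m n) (s : ℝ), 0 < m → 0 < n →
      avgKendallTau P ≤ K * (Real.log m + Real.log n) + s →
      (runtime P : ℝ) ≤ A * ((m * n : ℕ) : ℝ) ^ B * 2 ^ (D * s) := by
  obtain ⟨C, B, hC, h⟩ := exists_runtime_le
  obtain ⟨k, hk⟩ := exists_nat_ge (10 * B * |K|)
  refine ⟨C * 2 ^ (10 * B), B + k, 10 * B, Nat.mul_pos hC (by positivity), ?_⟩
  intro m n P s hm hn hP
  have hM : (1 : ℝ) ≤ ((m * n : ℕ) : ℝ) := by exact_mod_cast Nat.mul_pos hm hn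
  have hL : Real.log m + Real.log n = Real.log ((m * n : ℕ) : ℝ) := by
    rw [Nat.cast_mul, Real.log_mul] <;> positivity
  have hL0 : 0 ≤ Real.log ((m * n : ℕ) : ℝ) := Real.log_nonneg hM
  rw [hL] at hP
  have hpow : (2 : ℝ) ^ (10 * B * |K| * Real.log ((m * n : ℕ) : ℝ)) ≤ ((m * n : ℕ) : ℝ) ^ k :=
    le_trans (by gcongr; norm_num) (two_rpow_mul_log_le k hM)
  replace h := h m n P hm hn
  generalize ((m * n : ℕ) : ℝ) = M at *
  calc (runtime P : ℝ) ≤ C * M ^ B * 2 ^ (10 * B * (avgKendallTau P + 1)) := h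
    _ ≤ C * M ^ B * 2 ^ (10 * B * (|K| * Real.log M + s + 1)) := by
        gcongr
        · norm_num
        · exact hP.trans (by gcongr; exact le_abs_self K)
    _ = C * M ^ B * (2 ^ (10 * B * |K| * Real.log M) * 2 ^ (10 * B * s) * 2 ^ (10 * B)) := by
        rw [← Real.rpow_natCast 2 (10 * B), ← Real.rpow_add two_pos, ← Real.rpow_add two_pos]
        congr 2
        push_cast
        ring
    _ ≤ C * M ^ B * (M ^ k * 2 ^ (10 * B * s) * 2 ^ (10 * B)) := by gcongr
    _ = _ := by push_cast; ring

end Kemeny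

/-! ### Polynomial running time with high probability -/

theorem corollary1 (c₀ K₁ K₂ : ℝ) (hc₀ : 0 < c₀) :
    (∃ (p : Polynomial ℕ) (c : ℝ), 0 < c ∧
      ∀ (m n : ℕ) (P : Profile m n) (φ : Fin n → Set.Ioc (0 : ℝ) 1), 3 ≤ m →
        c₀ * ((m : ℝ) ^ 2 * ((m : ℝ) - 1) ^ 2) ≤ n →
        avgKendallTau P ≤ K₁ * (Real.log m + Real.log n) →
        (∑ j, (φ j : ℝ)) / n ≤ K₂ * ((Real.log m + Real.log n) / (m : ℝ) ^ 2) →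
        ∀ t : ℝ, 1 ≤ t →
          (mallowsProfile P φ).real
              {P' | ((p.eval (m * n) : ℕ) : ℝ) ^ t < (Kemeny.runtime P' : ℝ)}
            ≤ Real.exp (-(c * t ^ 2))) ∧
    (∃ q : Polynomial ℕ, ∀ δ : ℝ, 0 < δ → ∃ N : ℕ,
      ∀ (m n : ℕ) (P : Profile m n) (φ : Fin n → Set.Ioc (0 : ℝ) 1), 3 ≤ m →
        c₀ * ((m : ℝ) ^ 2 * ((m : ℝ) - 1) ^ 2) ≤ n →
        avgKendallTau P ≤ K₁ * (Real.log m + Real.log n) →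
        (∑ j, (φ j : ℝ)) / n ≤ K₂ * ((Real.log m + Real.log n) / (m : ℝ) ^ 2) →
        N ≤ m * n →
          1 - δ ≤ (mallowsProfile P φ).real
            {P' | Kemeny.runtime P' ≤ q.eval (m * n)}) := by
  obtain ⟨A, B, D, hA, hrun⟩ := Kemeny.exists_runtime_le_of_avgKendallTau_le (K₁ + 2 * K₂)
  have hpos : ∀ m n : ℕ, 3 ≤ m → c₀ * ((m : ℝ) ^ 2 * ((m : ℝ) - 1) ^ 2) ≤ n → 0 < n := by
    intro m n hm hn
    have hm' : (3 : ℝ) ≤ m := by exact_mod_cast hm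
    have hm1 : (0 : ℝ) < m - 1 := by linarith
    have : (0 : ℝ) < n := lt_of_lt_of_le (by positivity) hn
    exact_mod_cast this
  -- the running time exceeds the bound only if the average distance deviates by more than `s`
  have htail : ∀ (m n : ℕ) (P : Profile m n) (φ : Fin n → Set.Ioc (0 : ℝ) 1) (s : ℝ), 3 ≤ m →
      c₀ * ((m : ℝ) ^ 2 * ((m : ℝ) - 1) ^ 2) ≤ n →
      avgKendallTau P ≤ K₁ * (Real.log m + Real.log n) →
      (∑ j, (φ j : ℝ)) / n ≤ K₂ * ((Real.log m + Real.log n) / (m : ℝ) ^ 2) → 0 ≤ s →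
      (mallowsProfile P φ).real
        {P' | A * ((m * n : ℕ) : ℝ) ^ B * 2 ^ (D * s) < (Kemeny.runtime P' : ℝ)} ≤
      Real.exp (-(c₀ / 2 * s ^ 2)) := by
    intro m n P φ s hm hn hP hφ hs
    refine (MeasureTheory.measureReal_mono fun P' hP' => ?_).trans
      (mallowsProfile_avgKendallTau_ge hc₀ (by omega) P φ hn hs)
    simp only [Set.mem_ofPred_eq] at hP' ⊢
    by_contra! hlt
    refine hP'.not_ge (hrun m n P' s (by omega) ?_ ?_)
    · exact hpos m n hm hn
    · have hm0 : (0 : ℝ) < (m : ℝ) ^ 2 := by positivity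
      have h := mul_le_mul_of_nonneg_left hφ (by positivity : (0 : ℝ) ≤ 2 * (m : ℝ) ^ 2)
      have h' : 2 * (m : ℝ) ^ 2 * (K₂ * ((Real.log m + Real.log n) / (m : ℝ) ^ 2)) =
          2 * K₂ * (Real.log m + Real.log n) := by field_simp
      linarith
  have hM : ∀ m n : ℕ, 3 ≤ m → c₀ * ((m : ℝ) ^ 2 * ((m : ℝ) - 1) ^ 2) ≤ n → 1 ≤ m * n :=
    fun m n hm hn => Nat.mul_pos (by omega) (hpos m n hm hn)
  refine ⟨⟨Polynomial.C (A * 2 ^ D) * Polynomial.X ^ B, c₀ / 2, by positivity, ?_⟩,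
    ⟨Polynomial.C A * Polynomial.X ^ (B + D), ?_⟩⟩
  · intro m n P φ hm hn hP hφ t ht
    refine (MeasureTheory.measureReal_mono fun P' hP' => ?_).trans
      (htail m n P φ t hm hn hP hφ (by linarith))
    simp only [Set.mem_ofPred_eq, Polynomial.eval_mul, Polynomial.eval_C, Polynomial.eval_pow,
      Polynomial.eval_X] at hP' ⊢
    refine lt_of_le_of_lt ?_ hP'
    have h1 : (1 : ℝ) ≤ A * ((m * n : ℕ) : ℝ) ^ B := by
      exact_mod_cast Nat.mul_pos hA (Nat.pow_pos (hM m n hm hn))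
    calc (A : ℝ) * ((m * n : ℕ) : ℝ) ^ B * 2 ^ (D * t)
        ≤ (A * ((m * n : ℕ) : ℝ) ^ B) ^ t * 2 ^ (D * t) := by
          gcongr
          exact Real.self_le_rpow_of_one_le h1 ht
      _ = ((A * 2 ^ D * (m * n) ^ B : ℕ) : ℝ) ^ t := by
          rw [Real.rpow_mul (by norm_num), Real.rpow_natCast,
            ← Real.mul_rpow (by positivity) (by positivity)]
          push_cast
          congr 1
          ring
  · intro δ hδ
    -- the deviation `log (m n)` costs only another factor that is polynomial in `m n`
    have hlim : Filter.Tendsto (fun N : ℕ => Real.exp (-(c₀ / 2 * Real.log N ^ 2)))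
        Filter.atTop (nhds 0) := by
      refine Real.tendsto_exp_neg_atTop_nhds_zero.comp ?_
      refine Filter.Tendsto.const_mul_atTop (by positivity) ?_
      exact (Filter.tendsto_pow_atTop two_ne_zero).comp
        (Real.tendsto_log_atTop.comp tendsto_natCast_atTop_atTop)
    obtain ⟨N, hN⟩ := Filter.eventually_atTop.1 (hlim.eventually_le_const hδ)
    refine ⟨N, fun m n P φ hm hn hP hφ hmn => ?_⟩
    have hM1 := hM m n hm hn
    have hM1' : (1 : ℝ) ≤ ((m * n : ℕ) : ℝ) := by exact_mod_cast hM1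
    have hbad := (htail m n P φ (Real.log ((m * n : ℕ) : ℝ)) hm hn hP hφ
      (Real.log_nonneg hM1')).trans (hN _ hmn)
    have hpow : (2 : ℝ) ^ (D * Real.log ((m * n : ℕ) : ℝ)) ≤ ((m * n : ℕ) : ℝ) ^ D :=
      two_rpow_mul_log_le D hM1'
    rw [sub_le_comm, ← MeasureTheory.probReal_compl_eq_one_sub (.of_discrete)]
    refine (MeasureTheory.measureReal_mono fun P' hP' => ?_).trans hbad
    simp only [Set.mem_compl_iff, Set.mem_ofPred_eq, Polynomial.eval_mul, Polynomial.eval_C,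
      Polynomial.eval_pow, Polynomial.eval_X, not_le] at hP' ⊢
    refine lt_of_le_of_lt ?_ (Nat.cast_lt.2 hP')
    calc (A : ℝ) * ((m * n : ℕ) : ℝ) ^ B * 2 ^ (D * Real.log ((m * n : ℕ) : ℝ))
        ≤ A * ((m * n : ℕ) : ℝ) ^ B * ((m * n : ℕ) : ℝ) ^ D := by gcongr
      _ = _ := by push_cast; ring
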